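/- Consider a block Rayleigh fading channel with unit-variance complex Gaussian noise, in which the signal space is divided into coherence subspaces of dimension $N_c$. On each subspace the channel acts as multiplication by one coefficient $h\sim\mathcal{CN}(0,1)$, and the coefficients of different subspaces are independent. The average transmit energy per dimension is $\mathrm{SNR}$. In the training-based scheme a fraction $\eta\in[0,1]$ of the energy $N_c\,\mathrm{SNR}$ of a subspace is spent on one training dimension, in which the receiver observes $y_0=\sqrt{\eta N_c\mathrm{SNR}}\,h+w_0$ and forms the MMSE estimate $\hat h=\mathbb E[h\mid y_0]$. Each of the other $N_c-1$ dimensions carries a data symbol $x\sim\mathcal{CN}(0,1)$, received as $y=\sqrt{\rho}\,h\,x+w$ with $\rho=(1-\eta)N_c\,\mathrm{SNR}/(N_c-1)$ and $w\sim\mathcal{CN}(0,1)$, and is detected coherently, symbol by symbol, from $y$ and $\hat h$; here $h,w_0,x,w$ are independent. The average mutual information per dimension (in bits) of the scheme, with the energy split optimized, is $$I_{tr}(\mathrm{SNR})=\sup_{0\le\eta\le1}\frac{N_c-1}{N_c}\,I\big(x;\,(y,\hat h)\big).$$ Let $C_{coh}(\mathrm{SNR})=\mathbb E\big[\log_2(1+\mathrm{SNR}\,|h|^2)\big]$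 be the coherent capacity. A spectral efficiency $R(\mathrm{SNR})$ is called first-order optimal if it has the same limiting energy per bit $\frac{E_b}{N_0}_{\min}=\lim_{\mathrm{SNR}\downarrow0}\mathrm{SNR}/R(\mathrm{SNR})$ as $C_{coh}$. It is called second-order optimal if, in addition, it has the same wideband slope $$S_0=\lim_{\mathrm{SNR}\downarrow0}\frac{R(\mathrm{SNR})}{10\log_{10}\frac{\mathrm{SNR}}{R(\mathrm{SNR})}-10\log_{10}\frac{E_b}{N_0}_{\min}}\cdot 10\log_{10}2$$ as $C_{coh}$. Let $k>0$, $\mu>0$ and let the coherence dimension scale as $N_c=k/\mathrm{SNR}^{\mu}$. Then, as $\mathrm{SNR}\downarrow0$, $$I_{tr}\ \ge\ \log_2(e)\left[\mathrm{SNR}-\mathrm{SNR}^2-O\!\left(\mathrm{SNR}^{\frac{1+\mu}{2}}\right)\right],$$ with a constant depending only on $k$ and $\mu$; in particular $I_{tr}\ge\log_2(e)\big[\mathrm{SNR}-O(\mathrm{SNR}^{(1+\mu)/2})\big]$ if $\mu\le3$. Moreover, the scheme is first-order optimal if and only if $\mu>1$, and second-order optimal if and only if $\mu>3$. -/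

import Mathlib

open MeasureTheory ProbabilityTheory Filter Topology

noncomputable section

namespace TrainingSTF

/-- The circularly symmetric complex Gaussian law `CN(0,1)`: real and imaginary parts are
independent centred Gaussians of variance `1/2`, so that `E|z|² = 1`. -/
def stdCN : Measure ℂ :=
  ((gaussianReal 0 (1 / 2)).prod (gaussianReal 0 (1 / 2))).map
    (fun p : ℝ × ℝ => (⟨p.1, p.2⟩ : ℂ))

/-- Mutual information (in nats) of two random variables: the relative entropy of their joint
law with respect to the product of their marginal laws. -/
def mutualInfo {Ω α β : Type*} [MeasurableSpace Ω] [MeasurableSpace α] [MeasurableSpace β]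
    (P : Measure Ω) (X : Ω → α) (Y : Ω → β) : ENNReal :=
  InformationTheory.klDiv (P.map (fun ω => (X ω, Y ω))) ((P.map X).prod (P.map Y))

/-- The randomness seen by one data dimension of a coherence subspace: `(h, w₀, x, w)`, where
`h` is the fading coefficient of the subspace, `w₀` the noise in its training dimension,
`x` the data symbol and `w` the noise in the data dimension. -/
abbrev Sample : Type := ℂ × ℂ × ℂ × ℂ

/-- `h`, `w₀`, `x`, `w` are i.i.d. `CN(0,1)`: Rayleigh fading, white Gaussian noise and
(non-peaky) Gaussian signalling. -/
def sampleLaw : Measure Sample := stdCN.prod (stdCN.prod (stdCN.prod stdCN))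

/-- The fading coefficient. -/
def fading (ω : Sample) : ℂ := ω.1

/-- The unit-energy data symbol. -/
def dataSymbol (ω : Sample) : ℂ := ω.2.2.1

/-- Received symbol in the training dimension, training energy `E`. -/
def trainObs (E : ℝ) (ω : Sample) : ℂ := (Real.sqrt E : ℂ) * ω.1 + ω.2.1

/-- Received symbol in a data dimension, energy `ρ` per data symbol. -/
def dataObs (ρ : ℝ) (ω : Sample) : ℂ := (Real.sqrt ρ : ℂ) * ω.1 * ω.2.2.1 + ω.2.2.2

/-- The MMSE estimate of the fading coefficient from the training observation: its conditional
expectation given that observation. -/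
def mmseEstimate (E : ℝ) : Sample → ℂ :=
  condExp (MeasurableSpace.comap (trainObs E) inferInstance) sampleLaw fading

/-- Average mutual information, in bits per signal space dimension, for coherence dimension `Nc`,
signal-to-noise ratio `snr` and training energy fraction `η`. The energy of a coherence subspace
is `Nc * snr`. One dimension carries training, with energy `η * Nc * snr`; each of the remaining
`Nc - 1` dimensions has energy `(1 - η) * Nc * snr / (Nc - 1)` and contributes the mutual
information between its data symbol and what the coherent detector is given for that symbol,
namely the received symbol and the channel estimate. -/
def trainingRate (Nc snr η : ℝ) : ℝ :=
  (Nc - 1) / Nc *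
    ((mutualInfo sampleLaw dataSymbol
        (fun ω => (dataObs ((1 - η) * Nc * snr / (Nc - 1)) ω,
          mmseEstimate (η * Nc * snr) ω))).toReal / Real.log 2)

/-- Average mutual information of the training-based scheme with coherence dimension
`Nc = k / snr ^ μ` and the best split of the energy between training and data. -/
def avgMutualInfo (k μ snr : ℝ) : ℝ :=
  ⨆ η : Set.Icc (0 : ℝ) 1, trainingRate (k / snr ^ μ) snr η

/-- Coherent ergodic capacity of the Rayleigh fading channel, in bits per dimension. -/
def coherentCapacity (snr : ℝ) : ℝ :=
  ∫ h, Real.logb 2 (1 + snr * ‖h‖ ^ 2) ∂stdCN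

/-- The spectral efficiency `R` (bits per dimension as a function of the signal-to-noise ratio)
has energy per bit `snr / R snr` tending to `e` in the wideband limit. -/
def HasEbN0 (R : ℝ → ℝ) (e : ℝ) : Prop :=
  Tendsto (fun snr => snr / R snr) (𝓝[>] 0) (𝓝 e)

/-- `R`, whose limiting energy per bit is `e`, has wideband slope `S` (bits per dimension
per 3 dB): the slope of the spectral efficiency against the energy per bit in decibels. -/
def HasWidebandSlope (R : ℝ → ℝ) (e S : ℝ) : Prop :=
  Tendsto (fun snr => R snr / (10 * Real.logb 10 (snr / R snr) - 10 * Real.logb 10 e)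
    * (10 * Real.logb 10 2)) (𝓝[>] 0) (𝓝 S)

/-- `R` achieves the minimum energy per bit of the capacity `C`. -/
def FirstOrderOptimal (C R : ℝ → ℝ) : Prop :=
  ∃ e : ℝ, HasEbN0 C e ∧ HasEbN0 R e

/-- `R` achieves both the minimum energy per bit and the wideband slope of the capacity `C`. -/
def SecondOrderOptimal (C R : ℝ → ℝ) : Prop :=
  ∃ e S : ℝ, HasEbN0 C e ∧ HasEbN0 R e ∧ HasWidebandSlope C e S ∧ HasWidebandSlope R e S

end TrainingSTF

end

/-! Put E = η N_c SNR and s = 1/(1+E). The estimation error is Gaussian with variance s and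
independent of ĥ, so y = √ρ ĥ x + (noise whose variance given x is 1 + ρ s|x|²). Given (x, ĥ) the
law of y is an explicit Gaussian; given ĥ alone it is not Gaussian, and the mutual information has
to be bracketed (`channelLaw_information_bounds`). From above, the output density is replaced by the
Gaussian one of the same variance (maximum entropy). From below, the detector is replaced by one
that treats the noise as Gaussian of variance 1 + ρ s independent of x (worst-case noise). Both are
instances of log t ≤ t − 1, proved for general densities in `klDiv_prod_marginals_bounds`.

The moments 1, 2, 6 of |h|² turn the two bounds into ρ(1−s) − ρ² + (terms of size s ρ² and ρ³).
Hence, in nats, the rate is SNR − SNR² − SNR·L up to smaller terms, where L = 1 − (1−η)(1−s) is the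
fraction of energy lost to training and to estimation error. Since max(η, s) ≤ L ≤ η + s, no split
brings L below 1/(1+√A), with A = N_c SNR (`training_loss`), and η of order 1/√A attains that order.
The perturbation of the SNR² term by s and η is dominated by half of SNR·L
(`information_quadratic_bound`), so the loss survives in the upper bound.

With N_c = k/SNR^μ the loss SNR/√A has order SNR^((1+μ)/2) when μ > 1. It is o(SNR) exactly if μ > 1
and o(SNR²) exactly if μ > 3. The coherent capacity is SNR − SNR² + O(SNR³) in nats, so its energy
per bit is log 2 and its slope is 1. A loss of order SNR changes the former, and an extra δ SNR²
lowers the latter to at most 1/(1+δ) (`widebandSlope_lt_one`). -/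

namespace TrainingSTF

/-! ### Complex Gaussian densities and Gaussian conjugacy -/

/-- Lebesgue density of the centred circularly symmetric complex Gaussian law of variance `v`. -/
noncomputable def cnDensity (v : ℝ) (z : ℂ) : ℝ := (Real.pi * v)⁻¹ * Real.exp (-(‖z‖ ^ 2 / v))

lemma cnDensity_pos {v : ℝ} (hv : 0 < v) (z : ℂ) : 0 < cnDensity v z := by
  unfold cnDensity; positivity

lemma log_cnDensity {v : ℝ} (hv : 0 < v) (z : ℂ) :
    Real.log (cnDensity v z) = -Real.log Real.pi - Real.log v - ‖z‖ ^ 2 / v := by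
  have := Real.pi_pos
  rw [cnDensity, Real.log_mul (by positivity) (by positivity), Real.log_exp, Real.log_inv,
    Real.log_mul (by positivity) (by positivity)]
  ring

@[fun_prop]
lemma _root_.Measurable.cnDensity {α : Type*} [MeasurableSpace α] {v : α → ℝ} {z : α → ℂ}
    (hv : Measurable v) (hz : Measurable z) : Measurable fun a => cnDensity (v a) (z a) := by
  unfold TrainingSTF.cnDensity; fun_prop

instance : IsProbabilityMeasure stdCN := by
  unfold stdCN
  exact Measure.isProbabilityMeasure_map
    Complex.measurableEquivRealProd.symm.measurable.aemeasurable

lemma stdCN_eq_withDensity :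
    stdCN = (volume : Measure ℂ).withDensity fun z => ENNReal.ofReal (cnDensity 1 z) := by
  have hpdf : ∀ x y : ℝ, gaussianPDF 0 (1 / 2) x * gaussianPDF 0 (1 / 2) y
      = ENNReal.ofReal (cnDensity 1 (Complex.measurableEquivRealProd.symm (x, y))) := by
    intro x y
    rw [gaussianPDF, gaussianPDF, ← ENNReal.ofReal_mul (gaussianPDFReal_nonneg _ _ _)]
    congr 1
    have hs : Real.sqrt Real.pi * Real.sqrt Real.pi = Real.pi :=
      Real.mul_self_sqrt Real.pi_pos.le
    rw [gaussianPDFReal, gaussianPDFReal, cnDensity, Complex.sq_norm, Complex.normSq_apply]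
    have h2 : (2 * Real.pi * ((1 / 2 : NNReal) : ℝ)) = Real.pi := by push_cast; ring
    rw [h2, mul_mul_mul_comm, ← mul_inv, hs, ← Real.exp_add]
    congr 2
    · ring
    · simp [Complex.measurableEquivRealProd_symm_apply]; ring
  refine Measure.ext_of_lintegral _ fun f hf => ?_
  rw [lintegral_withDensity_eq_lintegral_mul _ (by fun_prop) hf]
  unfold stdCN
  have hm : Measurable (fun p : ℝ × ℝ => (⟨p.1, p.2⟩ : ℂ)) :=
    Complex.measurableEquivRealProd.symm.measurable
  rw [lintegral_map hf hm, gaussianReal_of_var_ne_zero _ (by norm_num),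
    prod_withDensity (by fun_prop) (by fun_prop),
    lintegral_withDensity_eq_lintegral_mul _ (by fun_prop)
      (show Measurable fun p : ℝ × ℝ => f ⟨p.1, p.2⟩ from hf.comp hm),
    ← (Complex.volume_preserving_equiv_real_prod.symm).lintegral_comp (by fun_prop)]
  refine lintegral_congr fun p => ?_
  simp only [Pi.mul_apply, hpdf]
  rfl

lemma lintegral_stdCN {f : ℂ → ENNReal} (hf : Measurable f) :
    ∫⁻ z, f z ∂stdCN = ∫⁻ z, ENNReal.ofReal (cnDensity 1 z) * f z := by
  rw [stdCN_eq_withDensity, lintegral_withDensity_eq_lintegral_mul _ (by fun_prop) hf]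
  rfl

/-- The law of `m + √v z` has density `cnDensity v (y - m)`. -/
lemma lintegral_stdCN_affine {f : ℂ → ENNReal} (hf : Measurable f) (m : ℂ) {v : ℝ} (hv : 0 < v) :
    ∫⁻ z, f (m + (Real.sqrt v : ℂ) * z) ∂stdCN
      = ∫⁻ y, ENNReal.ofReal (cnDensity v (y - m)) * f y := by
  have hs : Real.sqrt v ≠ 0 := (Real.sqrt_pos.2 hv).ne'
  have hF : Measurable fun y => ENNReal.ofReal (cnDensity v y) * f (m + y) := by fun_prop
  have h1 := lintegral_map (μ := (volume : Measure ℂ)) hF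
    (measurable_const_smul (Real.sqrt v))
  rw [Measure.map_addHaar_smul _ hs, lintegral_smul_measure] at h1
  rw [lintegral_stdCN (by fun_prop)]
  have h2 : ∫⁻ y, ENNReal.ofReal (cnDensity v (y - m)) * f y
      = ∫⁻ y, ENNReal.ofReal (cnDensity v y) * f (m + y) := by
    rw [← lintegral_add_left_eq_self (fun y => ENNReal.ofReal (cnDensity v (y - m)) * f y) m]
    simp
  -- ℂ has real dimension two, so dilation by √v has Jacobian v.
  have h3 : |(Real.sqrt v ^ Module.finrank ℝ ℂ)⁻¹| = v⁻¹ := by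
    rw [Complex.finrank_real_complex, Real.sq_sqrt hv.le, abs_of_pos (by positivity)]
  rw [h3, smul_eq_mul] at h1
  have h4 : ∀ z : ℂ, ENNReal.ofReal (cnDensity v (Real.sqrt v • z)) * f (m + Real.sqrt v • z)
      = ENNReal.ofReal v⁻¹ *
        (ENNReal.ofReal (cnDensity 1 z) * f (m + (Real.sqrt v : ℂ) * z)) := by
    intro z
    rw [← mul_assoc, ← ENNReal.ofReal_mul (by positivity), Complex.real_smul]
    congr 2
    have : ‖(Real.sqrt v : ℂ) * z‖ ^ 2 = v * ‖z‖ ^ 2 := by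
      rw [norm_mul, mul_pow, Complex.norm_real, Real.norm_eq_abs, sq_abs, Real.sq_sqrt hv.le]
    rw [cnDensity, cnDensity, this]
    field_simp
  simp_rw [h4] at h1
  rw [lintegral_const_mul _ (by fun_prop)] at h1
  rw [h2]
  have h5 : ENNReal.ofReal v⁻¹ ≠ 0 := by simpa using hv
  exact ((ENNReal.mul_right_inj h5 ENNReal.ofReal_ne_top).1 h1).symm

lemma lintegral_cnDensity_sub (m : ℂ) {v : ℝ} (hv : 0 < v) :
    ∫⁻ y, ENNReal.ofReal (cnDensity v (y - m)) = 1 := by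
  simpa using (lintegral_stdCN_affine (f := fun _ => 1) (by fun_prop) m hv).symm

/-- Completing the square: the prior of `x` times the likelihood of `y` given `x` equals the
marginal of `y` times the posterior of `x`. -/
lemma cnDensity_mul_cnDensity (m x y : ℂ) {v : ℝ} (hv : 0 < v) :
    cnDensity 1 x * cnDensity v (y - m * x)
      = cnDensity (v + ‖m‖ ^ 2) y *
        cnDensity (v / (v + ‖m‖ ^ 2)) (x - (starRingEnd ℂ m / ((v + ‖m‖ ^ 2 : ℝ) : ℂ)) * y) := by
  have hd : 0 < v + ‖m‖ ^ 2 := by positivity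
  have hexp : ∀ a b c d : ℝ,
      a * Real.exp b * (c * Real.exp d) = a * c * Real.exp (b + d) := by
    intro a b c d; rw [Real.exp_add]; ring
  unfold cnDensity
  rw [hexp, hexp]
  congr 1
  · field_simp
  congr 1
  -- This is the identity of exponents after clearing the denominators v and v + ‖m‖².
  have key : ‖x‖ ^ 2 * v * (v + ‖m‖ ^ 2) + ‖y - m * x‖ ^ 2 * (v + ‖m‖ ^ 2)
      = ‖y‖ ^ 2 * v + ‖((v + ‖m‖ ^ 2 : ℝ) : ℂ) * x - starRingEnd ℂ m * y‖ ^ 2 := by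
    simp only [Complex.sq_norm, Complex.normSq_apply, Complex.sub_re, Complex.sub_im,
      Complex.mul_re, Complex.mul_im, Complex.conj_re, Complex.conj_im, Complex.ofReal_re,
      Complex.ofReal_im]
    ring
  have hx : ‖x - (starRingEnd ℂ m / ((v + ‖m‖ ^ 2 : ℝ) : ℂ)) * y‖ ^ 2
      = ‖((v + ‖m‖ ^ 2 : ℝ) : ℂ) * x - starRingEnd ℂ m * y‖ ^ 2 / (v + ‖m‖ ^ 2) ^ 2 := by
    have hdc : ((v + ‖m‖ ^ 2 : ℝ) : ℂ) ≠ 0 := by exact_mod_cast hd.ne'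
    have : x - (starRingEnd ℂ m / ((v + ‖m‖ ^ 2 : ℝ) : ℂ)) * y
        = (((v + ‖m‖ ^ 2 : ℝ) : ℂ) * x - starRingEnd ℂ m * y) / ((v + ‖m‖ ^ 2 : ℝ) : ℂ) := by
      field_simp
    rw [this, norm_div, div_pow, Complex.norm_real, Real.norm_eq_abs, sq_abs]
  rw [hx]
  set N := ‖((v + ‖m‖ ^ 2 : ℝ) : ℂ) * x - starRingEnd ℂ m * y‖ ^ 2
  set d := v + ‖m‖ ^ 2
  have : N = ‖x‖ ^ 2 * v * d + ‖y - m * x‖ ^ 2 * d - ‖y‖ ^ 2 * v := by linarith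
  rw [this]
  field_simp
  ring

/-- Averaging a Gaussian likelihood over a standard Gaussian input. -/
lemma lintegral_cnDensity_sub_mul (m y : ℂ) {v : ℝ} (hv : 0 < v) :
    ∫⁻ x, ENNReal.ofReal (cnDensity v (y - m * x)) ∂stdCN
      = ENNReal.ofReal (cnDensity (v + ‖m‖ ^ 2) y) := by
  have hd : 0 < v + ‖m‖ ^ 2 := by positivity
  rw [lintegral_stdCN (by fun_prop)]
  simp_rw [← ENNReal.ofReal_mul (cnDensity_pos one_pos _).le, cnDensity_mul_cnDensity m _ y hv,
    ENNReal.ofReal_mul (cnDensity_pos hd _).le]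
  rw [lintegral_const_mul _ (by fun_prop), lintegral_cnDensity_sub _ (by positivity), mul_one]

/-- Joint law of an observation `m x + w` and of `x`, in terms of the independent pair formed by
the normalized observation and the normalized estimation error. -/
lemma lintegral_stdCN_posterior (m : ℂ) {f : ℂ × ℂ → ENNReal} (hf : Measurable f) :
    ∫⁻ x, ∫⁻ w, f (m * x + w, x) ∂stdCN ∂stdCN
      = ∫⁻ u, ∫⁻ v, f ((Real.sqrt (1 + ‖m‖ ^ 2) : ℂ) * u,
          (starRingEnd ℂ m / ((1 + ‖m‖ ^ 2 : ℝ) : ℂ)) * ((Real.sqrt (1 + ‖m‖ ^ 2) : ℂ) * u)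
            + (Real.sqrt (1 / (1 + ‖m‖ ^ 2)) : ℂ) * v) ∂stdCN ∂stdCN := by
  have hd : 0 < 1 + ‖m‖ ^ 2 := by positivity
  have h1 : ∀ x, ∫⁻ w, f (m * x + w, x) ∂stdCN
      = ∫⁻ y, ENNReal.ofReal (cnDensity 1 (y - m * x)) * f (y, x) := by
    intro x
    simpa using lintegral_stdCN_affine (f := fun y => f (y, x)) (by fun_prop) (m * x) one_pos
  have h2 : ∀ y, ∫⁻ v, f (y, (starRingEnd ℂ m / ((1 + ‖m‖ ^ 2 : ℝ) : ℂ)) * y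
        + (Real.sqrt (1 / (1 + ‖m‖ ^ 2)) : ℂ) * v) ∂stdCN
      = ∫⁻ x, ENNReal.ofReal (cnDensity (1 / (1 + ‖m‖ ^ 2))
          (x - (starRingEnd ℂ m / ((1 + ‖m‖ ^ 2 : ℝ) : ℂ)) * y)) * f (y, x) := by
    intro y
    exact lintegral_stdCN_affine (f := fun x => f (y, x)) (by fun_prop) _ (by positivity)
  simp_rw [h1]
  rw [lintegral_stdCN (by fun_prop)]
  simp_rw [h2]
  have h3 := lintegral_stdCN_affine (f := fun y => ∫⁻ x, ENNReal.ofReal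
    (cnDensity (1 / (1 + ‖m‖ ^ 2))
          (x - (starRingEnd ℂ m / ((1 + ‖m‖ ^ 2 : ℝ) : ℂ)) * y)) * f (y, x)) (by fun_prop) 0 hd
  simp only [zero_add, sub_zero] at h3
  rw [h3]
  simp_rw [← lintegral_const_mul' _ _ ENNReal.ofReal_ne_top]
  -- Both sides are now Lebesgue integrals over (x, y); Bayes' rule in the form
  -- `cnDensity_mul_cnDensity` identifies the integrands.
  rw [lintegral_lintegral_swap (by fun_prop)]
  refine lintegral_congr fun y => lintegral_congr fun x => ?_
  rw [← mul_assoc, ← mul_assoc, ← ENNReal.ofReal_mul (cnDensity_pos one_pos _).le,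
    ← ENNReal.ofReal_mul (cnDensity_pos hd _).le, cnDensity_mul_cnDensity m x y one_pos]

/-- The law of `α v + w`. -/
lemma lintegral_stdCN_mul_add (α : ℂ) {f : ℂ → ENNReal} (hf : Measurable f) :
    ∫⁻ v, ∫⁻ w, f (α * v + w) ∂stdCN ∂stdCN
      = ∫⁻ z, f ((Real.sqrt (1 + ‖α‖ ^ 2) : ℂ) * z) ∂stdCN := by
  simpa using lintegral_stdCN_posterior α (f := fun p => f p.1) (by fun_prop)

/-! ### Mutual information bounds from comparison densities -/

section DensityBounds

variable {X Y : Type*} [MeasurableSpace X] [MeasurableSpace Y]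

lemma integrable_and_integral_le_one_of_lintegral_le_one {α : Type*} [MeasurableSpace α]
    {P : Measure α} {W : α → ℝ} (hW : Measurable W) (hW0 : ∀ a, 0 ≤ W a)
    (h : ∫⁻ a, ENNReal.ofReal (W a) ∂P ≤ 1) : Integrable W P ∧ ∫ a, W a ∂P ≤ 1 := by
  constructor
  · refine ⟨hW.aestronglyMeasurable, ?_⟩
    rw [hasFiniteIntegral_iff_ofReal (ae_of_all _ hW0)]
    exact h.trans_lt ENNReal.one_lt_top
  · rw [integral_eq_lintegral_of_nonneg_ae (ae_of_all _ hW0) hW.aestronglyMeasurable]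
    exact ENNReal.toReal_le_of_le_ofReal zero_le_one (by simpa using h)

/-- Bounds for the mutual information carried by a joint law with conditional density `p` of the
output given the input, `γ` being the law of the input. Above, by the divergence from an arbitrary
output density `r`; below, by the rate of a mismatched detector with metric `f`. -/
theorem klDiv_prod_marginals_bounds {γ : Measure X} [IsProbabilityMeasure γ] {lam : Measure Y}
    [SigmaFinite lam] {p : X × Y → ℝ} (hpm : Measurable p) (hp0 : ∀ z, 0 < p z)
    (hp1 : ∀ z, p z ≤ 1) (hp : ∀ x, ∫⁻ y, ENNReal.ofReal (p (x, y)) ∂lam = 1)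
    {P : Measure (X × Y)} (hP : P = (γ.prod lam).withDensity fun z => ENNReal.ofReal (p z))
    (hlogp : Integrable (fun z => Real.log (p z)) P)
    {r : Y → ℝ} (hrm : Measurable r) (hr0 : ∀ y, 0 < r y)
    (hr : ∫⁻ y, ENNReal.ofReal (r y) ∂lam ≤ 1)
    (hlogr : Integrable (fun z => Real.log (r z.2)) P)
    {f : X × Y → ℝ} (hfm : Measurable f) (hf0 : ∀ z, 0 < f z)
    (hf : ∀ y, ∫⁻ x, ENNReal.ofReal (f (x, y)) ∂γ = ENNReal.ofReal (r y))
    (hlogf : Integrable (fun z => Real.log (f z)) P) :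
    (InformationTheory.klDiv P ((P.map Prod.fst).prod (P.map Prod.snd))).toReal
        ≤ ∫ z, Real.log (p z) ∂P - ∫ z, Real.log (r z.2) ∂P ∧
    ∫ z, Real.log (f z) ∂P - ∫ z, Real.log (r z.2) ∂P
        ≤ (InformationTheory.klDiv P ((P.map Prod.fst).prod (P.map Prod.snd))).toReal := by
  have hlint : ∀ F : X × Y → ENNReal, Measurable F →
      ∫⁻ z, F z ∂P = ∫⁻ x, ∫⁻ y, ENNReal.ofReal (p (x, y)) * F (x, y) ∂lam ∂γ := by
    intro F hF
    rw [hP, lintegral_withDensity_eq_lintegral_mul _ (by fun_prop) hF,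
      lintegral_prod _ (by fun_prop)]
    rfl
  have hlint' : ∀ F : X × Y → ENNReal, Measurable F →
      ∫⁻ z, F z ∂P = ∫⁻ y, ∫⁻ x, ENNReal.ofReal (p (x, y)) * F (x, y) ∂γ ∂lam := by
    intro F hF
    rw [hlint F hF, lintegral_lintegral_swap (by fun_prop)]
  have hPprob : IsProbabilityMeasure P := ⟨by
    rw [← lintegral_one, hlint _ measurable_const]
    simp [hp]⟩
  -- output density
  set Q : Y → ENNReal := fun y => ∫⁻ x, ENNReal.ofReal (p (x, y)) ∂γ with hQ
  have hQm : Measurable Q := Measurable.lintegral_prod_left' (f := fun z => ENNReal.ofReal (p z))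
    (by fun_prop)
  have hQ1 : ∀ y, Q y ≤ 1 := fun y => by
    calc Q y ≤ ∫⁻ _, 1 ∂γ := lintegral_mono fun x => by simpa using hp1 (x, y)
      _ = 1 := by simp
  have hQ0 : ∀ y, Q y ≠ 0 := fun y h => by
    rw [hQ, lintegral_eq_zero_iff (by fun_prop)] at h
    obtain ⟨x, hx⟩ := h.exists
    simp only [Pi.zero_apply, ENNReal.ofReal_eq_zero] at hx
    exact absurd (hp0 (x, y)) hx.not_gt
  have hQt : ∀ y, Q y ≠ ⊤ := fun y => ((hQ1 y).trans_lt ENNReal.one_lt_top).ne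
  set q : Y → ℝ := fun y => (Q y).toReal with hq
  have hqm : Measurable q := hQm.ennreal_toReal
  have hq0 : ∀ y, 0 < q y := fun y => ENNReal.toReal_pos (hQ0 y) (hQt y)
  have hq1 : ∀ y, q y ≤ 1 := fun y => ENNReal.toReal_le_of_le_ofReal zero_le_one
    (by simpa using hQ1 y)
  have hofq : ∀ y, ENNReal.ofReal (q y) = Q y := fun y => ENNReal.ofReal_toReal (hQt y)
  -- marginals
  have hfst : P.map Prod.fst = γ := by
    refine Measure.ext_of_lintegral _ fun F hF => ?_
    rw [lintegral_map hF measurable_fst, hlint _ (by fun_prop)]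
    refine lintegral_congr fun x => ?_
    dsimp only
    rw [lintegral_mul_const _ (by fun_prop), hp, one_mul]
  have hsnd : P.map Prod.snd = lam.withDensity Q := by
    refine Measure.ext_of_lintegral _ fun F hF => ?_
    rw [lintegral_map hF measurable_snd, hlint' _ (by fun_prop),
      lintegral_withDensity_eq_lintegral_mul _ hQm hF]
    refine lintegral_congr fun y => ?_
    dsimp only
    rw [lintegral_mul_const _ (by fun_prop)]
    rfl
  set PQ := (P.map Prod.fst).prod (P.map Prod.snd) with hPQdef
  have hPQ : PQ = (γ.prod lam).withDensity fun z => Q z.2 := by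
    rw [hPQdef, hfst, hsnd, prod_withDensity_right hQm]
  have hsndprob : IsProbabilityMeasure (P.map Prod.snd) :=
    Measure.isProbabilityMeasure_map measurable_snd.aemeasurable
  have hfstprob : IsProbabilityMeasure (P.map Prod.fst) :=
    Measure.isProbabilityMeasure_map measurable_fst.aemeasurable
  have hPd : P = PQ.withDensity fun z => ENNReal.ofReal (p z / q z.2) := by
    rw [hPQ, ← withDensity_mul _ (by fun_prop) (by fun_prop), hP]
    congr 1
    funext z
    rw [Pi.mul_apply, ← hofq, ← ENNReal.ofReal_mul (hq0 _).le, mul_div_cancel₀ _ (hq0 _).ne']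
  have hac : P ≪ PQ := by rw [hPd]; exact withDensity_absolutelyContinuous _ _
  have hllr : llr P PQ =ᵐ[P] fun z => Real.log (p z) - Real.log (q z.2) := by
    have h1 : P.rnDeriv PQ =ᵐ[PQ] fun z => ENNReal.ofReal (p z / q z.2) := by
      conv_lhs => rw [hPd]
      exact Measure.rnDeriv_withDensity _ (by fun_prop)
    filter_upwards [hac.ae_le h1] with z hz
    rw [llr, hz, ENNReal.toReal_ofReal (div_pos (hp0 _) (hq0 _)).le,
      Real.log_div (hp0 _).ne' (hq0 _).ne']
  have hkl : (InformationTheory.klDiv P PQ).toReal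
      = ∫ z, (Real.log (p z) - Real.log (q z.2)) ∂P := by
    rw [InformationTheory.toReal_klDiv_of_measure_eq hac (by simp [hPQdef])]
    exact integral_congr_ae hllr
  -- comparison of `q` with `r`
  obtain ⟨hWi, hW1⟩ := integrable_and_integral_le_one_of_lintegral_le_one (P := P)
    (W := fun z => r z.2 / q z.2) (by fun_prop) (fun z => (div_pos (hr0 _) (hq0 _)).le) (by
      rw [hlint' _ (by fun_prop)]
      refine le_trans (le_of_eq (lintegral_congr fun y => ?_)) hr
      dsimp only
      rw [lintegral_mul_const _ (by fun_prop)]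
      change Q y * _ = _
      rw [← hofq, ← ENNReal.ofReal_mul (hq0 _).le, mul_div_cancel₀ _ (hq0 _).ne'])
  -- Gibbs' inequality pointwise: log t ≤ t − 1 at t = r/q, where r/q has mean at most one.
  have hqr : ∀ z : X × Y, -Real.log (q z.2) ≤ -Real.log (r z.2) + r z.2 / q z.2 - 1 := by
    intro z
    have := Real.log_le_sub_one_of_pos (div_pos (hr0 z.2) (hq0 z.2))
    rw [Real.log_div (hr0 _).ne' (hq0 _).ne'] at this
    linarith
  -- The bound p ≤ 1 gives −log q ≥ 0, so the one-sided estimate `hqr` already yields integrability.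
  have hlogq : Integrable (fun z : X × Y => Real.log (q z.2)) P := by
    refine Integrable.mono' ((hlogr.neg.add hWi).sub (integrable_const 1))
      (Real.measurable_log.comp (hqm.comp measurable_snd)).aestronglyMeasurable
      (ae_of_all _ fun z => ?_)
    rw [Real.norm_eq_abs, abs_of_nonpos (Real.log_nonpos (hq0 _).le (hq1 _))]
    exact hqr z
  -- comparison with the mismatched detector
  obtain ⟨hVi, hV1⟩ := integrable_and_integral_le_one_of_lintegral_le_one (P := P)
    (W := fun z => f z * q z.2 / (r z.2 * p z)) (by fun_prop)
    (fun z => (div_pos (mul_pos (hf0 _) (hq0 _)) (mul_pos (hr0 _) (hp0 _))).le) (by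
      rw [hlint' _ (by fun_prop)]
      have h1 : ∫⁻ y, Q y ∂lam = 1 := by
        have := hsndprob.measure_univ
        rwa [hsnd, withDensity_apply _ MeasurableSet.univ, setLIntegral_univ] at this
      rw [← h1]
      refine le_of_eq (lintegral_congr fun y => ?_)
      have h2 : ∀ x, ENNReal.ofReal (p (x, y)) * ENNReal.ofReal (f (x, y) * q y / (r y * p (x, y)))
          = ENNReal.ofReal (f (x, y)) * ENNReal.ofReal (q y / r y) := by
        intro x
        rw [← ENNReal.ofReal_mul (hp0 _).le, ← ENNReal.ofReal_mul (hf0 _).le]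
        congr 1
        have := (hp0 (x, y)).ne'
        have := (hr0 y).ne'
        field_simp
      simp_rw [h2]
      rw [lintegral_mul_const _ (by fun_prop), hf, ← ENNReal.ofReal_mul (hr0 _).le,
        mul_div_cancel₀ _ (hr0 _).ne', hofq])
  -- f/r is a backward conditional density of the input given the output, and p/q is the true one.
  -- The quotient (f/r)/(p/q) integrates to one under P, so log t ≤ t − 1 makes the true one
  -- optimal.
  have hfr : ∀ z : X × Y, Real.log (f z) - Real.log (r z.2) ≤
      (Real.log (p z) - Real.log (q z.2)) + f z * q z.2 / (r z.2 * p z) - 1 := by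
    intro z
    have hfq := mul_pos (hf0 z) (hq0 z.2)
    have hrp := mul_pos (hr0 z.2) (hp0 z)
    have := Real.log_le_sub_one_of_pos (div_pos hfq hrp)
    rw [Real.log_div hfq.ne' hrp.ne', Real.log_mul (hf0 _).ne' (hq0 _).ne',
      Real.log_mul (hr0 _).ne' (hp0 _).ne'] at this
    linarith
  rw [hkl]
  constructor
  · have h1 := integral_mono hlogq.neg ((hlogr.neg.add hWi).sub (integrable_const 1)) hqr
    rw [integral_neg', integral_sub' (hlogr.neg.add hWi) (integrable_const 1),
      integral_add' hlogr.neg hWi, integral_neg'] at h1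
    rw [integral_sub hlogp hlogq]
    simp only [integral_const, probReal_univ, smul_eq_mul, one_mul] at h1
    linarith
  · have h1 := integral_mono (hlogf.sub hlogr)
      (((hlogp.sub hlogq).add hVi).sub (integrable_const 1)) hfr
    rw [integral_sub' hlogf hlogr, integral_sub' ((hlogp.sub hlogq).add hVi) (integrable_const 1),
      integral_add' (hlogp.sub hlogq) hVi, integral_sub' hlogp hlogq] at h1
    rw [integral_sub hlogp hlogq]
    simp only [integral_const, probReal_univ, smul_eq_mul, one_mul] at h1
    linarith

end DensityBounds

/-! ### Moments of the complex Gaussian law -/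

lemma integral_stdCN (f : ℂ → ℝ) : ∫ z, f z ∂stdCN = ∫ z, cnDensity 1 z * f z := by
  rw [stdCN_eq_withDensity, integral_withDensity_eq_integral_toReal_smul (by fun_prop)
    (ae_of_all _ fun _ => ENNReal.ofReal_lt_top)]
  refine integral_congr_ae (ae_of_all _ fun z => ?_)
  simp only [ENNReal.toReal_ofReal (cnDensity_pos one_pos z).le, smul_eq_mul]

/-- |z|² is a unit exponential variable, whence the factorials. The second moment 2 produces the
term −SNR², the third moment 6 bounds the cubic remainder. -/
lemma integral_norm_pow_stdCN (n : ℕ) : ∫ z, (‖z‖ ^ 2) ^ n ∂stdCN = n.factorial := by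
  rw [integral_stdCN]
  have h := Complex.integral_rpow_mul_exp_neg_rpow (p := 2) (q := 2 * n) (by norm_num)
    (by have : (0 : ℝ) ≤ n := n.cast_nonneg
        linarith)
  have h1 : ∀ z : ℂ, cnDensity 1 z * (‖z‖ ^ 2) ^ n
      = Real.pi⁻¹ * (‖z‖ ^ (2 * n : ℝ) * Real.exp (-‖z‖ ^ (2 : ℝ))) := by
    intro z
    rw [cnDensity, Real.rpow_ofNat, ← pow_mul]
    rw [show (2 * n : ℝ) = ((2 * n : ℕ) : ℝ) by push_cast; ring, Real.rpow_natCast]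
    simp only [mul_one, div_one]
    ring
  simp_rw [h1]
  rw [integral_const_mul, h, show ((2 * n + 2) / 2 : ℝ) = n + 1 by ring, Real.Gamma_nat_eq_factorial]
  field_simp

/-- The Bochner integral of a non-integrable function is 0, whereas these integrals are n! ≠ 0. -/
lemma integrable_norm_pow_stdCN (n : ℕ) : Integrable (fun z : ℂ => (‖z‖ ^ 2) ^ n) stdCN := by
  by_contra h
  have := integral_norm_pow_stdCN n
  rw [integral_undef h] at this
  exact (Nat.factorial_ne_zero n) (by exact_mod_cast this.symm)

lemma integrable_id_stdCN : Integrable (fun z : ℂ => z) stdCN := by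
  refine Integrable.mono' ((integrable_norm_pow_stdCN 1).add (integrable_const 1))
    measurable_id.aestronglyMeasurable (ae_of_all _ fun z => ?_)
  simp only [Pi.add_apply, pow_one]
  nlinarith [sq_nonneg (‖z‖ - 1), norm_nonneg z]

lemma integral_id_stdCN : ∫ z, z ∂stdCN = 0 := by
  have h : ∫ z, z ∂stdCN = ∫ z : ℂ, (cnDensity 1 z) • z := by
    rw [stdCN_eq_withDensity, integral_withDensity_eq_integral_toReal_smul (by fun_prop)
      (ae_of_all _ fun _ => ENNReal.ofReal_lt_top)]
    refine integral_congr_ae (ae_of_all _ fun z => ?_)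
    simp only [ENNReal.toReal_ofReal (cnDensity_pos one_pos z).le]
  have h2 := integral_neg_eq_self (fun z : ℂ => (cnDensity 1 z) • z) volume
  have h3 : ∀ z : ℂ, cnDensity 1 (-z) • (-z) = -(cnDensity 1 z • z) := by
    intro z; simp [cnDensity]
  simp_rw [h3] at h2
  rw [integral_neg] at h2
  rw [h]
  exact self_eq_neg.1 h2.symm

/-! ### The MMSE estimate and the independence of its error -/

instance : IsProbabilityMeasure sampleLaw := by unfold sampleLaw; infer_instance

lemma lintegral_sampleLaw {f : Sample → ENNReal} (hf : Measurable f) :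
    ∫⁻ ω, f ω ∂sampleLaw
      = ∫⁻ h, ∫⁻ w₀, ∫⁻ x, ∫⁻ w, f (h, w₀, x, w) ∂stdCN ∂stdCN ∂stdCN ∂stdCN := by
  unfold sampleLaw
  rw [lintegral_prod _ (by fun_prop)]
  refine lintegral_congr fun h => ?_
  rw [lintegral_prod _ (by fun_prop)]
  refine lintegral_congr fun w₀ => ?_
  rw [lintegral_prod _ (by fun_prop)]

@[fun_prop]
lemma measurable_fading : Measurable fading := measurable_fst

@[fun_prop]
lemma measurable_dataSymbol : Measurable dataSymbol := by unfold dataSymbol; fun_prop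

@[fun_prop]
lemma measurable_trainObs (E : ℝ) : Measurable (trainObs E) := by unfold trainObs; fun_prop

@[fun_prop]
lemma measurable_dataObs (ρ : ℝ) : Measurable (dataObs ρ) := by unfold dataObs; fun_prop

/-- The gain of the linear MMSE estimator. -/
noncomputable def mmseGain (E : ℝ) : ℝ := Real.sqrt E / (1 + E)

lemma lintegral_trainObs {E : ℝ} (hE : 0 ≤ E) {f : ℂ × ℂ → ENNReal} (hf : Measurable f) :
    ∫⁻ h, ∫⁻ w, f ((Real.sqrt E : ℂ) * h + w, h) ∂stdCN ∂stdCN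
      = ∫⁻ u, ∫⁻ v, f ((Real.sqrt (1 + E) : ℂ) * u,
          (mmseGain E : ℂ) * ((Real.sqrt (1 + E) : ℂ) * u)
            + (Real.sqrt (1 / (1 + E)) : ℂ) * v) ∂stdCN ∂stdCN := by
  have h := lintegral_stdCN_posterior (Real.sqrt E : ℂ) hf
  have h2 : ‖(Real.sqrt E : ℂ)‖ ^ 2 = E := by
    rw [Complex.norm_real, Real.norm_eq_abs, sq_abs, Real.sq_sqrt hE]
  rw [h2] at h
  rw [h, Complex.conj_ofReal, ← Complex.ofReal_div]
  rfl

/-- The training observation and the estimation error are independent. -/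
lemma map_trainObs_error {E : ℝ} (hE : 0 ≤ E) :
    sampleLaw.map (fun ω => (trainObs E ω, fading ω - mmseGain E * trainObs E ω))
      = (stdCN.map fun u => (Real.sqrt (1 + E) : ℂ) * u).prod
          (stdCN.map fun v => (Real.sqrt (1 / (1 + E)) : ℂ) * v) := by
  rw [Measure.map_prod_map _ _ (by fun_prop) (by fun_prop)]
  refine Measure.ext_of_lintegral _ fun f hf => ?_
  rw [lintegral_map hf (by fun_prop), lintegral_map hf (by fun_prop),
    lintegral_sampleLaw (by fun_prop), lintegral_prod _ (by fun_prop)]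
  have h := lintegral_trainObs hE (f := fun q => f (q.1, q.2 - mmseGain E * q.1)) (by fun_prop)
  simp only [add_sub_cancel_left] at h
  simp only [lintegral_const, measure_univ, mul_one, trainObs, fading, Prod.map_apply]
  exact h

lemma integrable_fading : Integrable fading sampleLaw :=
  integrable_id_stdCN.comp_fst _

lemma integrable_trainObs (E : ℝ) : Integrable (trainObs E) sampleLaw := by
  refine (integrable_fading.const_mul _).add ?_
  exact (integrable_id_stdCN.comp_fst (stdCN.prod stdCN)).comp_snd stdCN

/-- The fading coefficient is a linear function of the observation plus an error that is centred and
independent of it; conditioning keeps the first part and kills the second. -/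
lemma mmseEstimate_ae_eq {E : ℝ} (hE : 0 ≤ E) :
    mmseEstimate E =ᵐ[sampleLaw] fun ω => (mmseGain E : ℂ) * trainObs E ω := by
  set err : Sample → ℂ := fun ω => fading ω - mmseGain E * trainObs E ω with herr
  have herrm : Measurable err := by rw [herr]; fun_prop
  have hpair := map_trainObs_error hE
  have hprob1 : IsProbabilityMeasure (stdCN.map fun u => (Real.sqrt (1 + E) : ℂ) * u) :=
    Measure.isProbabilityMeasure_map (by fun_prop)
  have hprob2 : IsProbabilityMeasure (stdCN.map fun u => (Real.sqrt (1 / (1 + E)) : ℂ) * u) :=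
    Measure.isProbabilityMeasure_map (by fun_prop)
  have h1 : sampleLaw.map (trainObs E) = stdCN.map fun u => (Real.sqrt (1 + E) : ℂ) * u := by
    have := congrArg (Measure.map Prod.fst) hpair
    rwa [Measure.map_map measurable_fst (by fun_prop), Measure.map_fst_prod, measure_univ,
      one_smul] at this
  have h2 : sampleLaw.map err = stdCN.map fun u => (Real.sqrt (1 / (1 + E)) : ℂ) * u := by
    have := congrArg (Measure.map Prod.snd) hpair
    rwa [Measure.map_map measurable_snd (by fun_prop), Measure.map_snd_prod, measure_univ,
      one_smul] at this
  have hind : IndepFun err (trainObs E) sampleLaw := by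
    refine IndepFun.symm ?_
    rw [indepFun_iff_map_prod_eq_prod_map_map (by fun_prop) (by fun_prop), h1, h2]
    exact hpair
  have hmean : ∫ ω, err ω ∂sampleLaw = 0 := by
    have := integral_map (μ := sampleLaw) (φ := err) (f := fun z : ℂ => z) herrm.aemeasurable
      measurable_id.aestronglyMeasurable
    rw [← this, h2, integral_map (f := fun z : ℂ => z) (by fun_prop)
      measurable_id.aestronglyMeasurable, integral_const_mul, integral_id_stdCN, mul_zero]
  have hle : MeasurableSpace.comap (trainObs E) inferInstance ≤
      (inferInstance : MeasurableSpace Sample) := (measurable_trainObs E).comap_le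
  have hint : Integrable (fun ω => (mmseGain E : ℂ) * trainObs E ω) sampleLaw :=
    (integrable_trainObs E).const_mul _
  have herri : Integrable err sampleLaw := integrable_fading.sub hint
  have hsum : fading = (fun ω => (mmseGain E : ℂ) * trainObs E ω) + err := by
    funext ω; simp [herr]
  have hsm : StronglyMeasurable[MeasurableSpace.comap (trainObs E) inferInstance]
      (fun ω => (mmseGain E : ℂ) * trainObs E ω) :=
    ((comap_measurable (trainObs E)).const_mul _).stronglyMeasurable
  have hce : condExp (MeasurableSpace.comap (trainObs E) inferInstance) sampleLaw err
      =ᵐ[sampleLaw] fun _ => ∫ ω, err ω ∂sampleLaw :=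
    condExp_indep_eq herrm.comap_le hle (comap_measurable err).stronglyMeasurable hind
  unfold mmseEstimate
  rw [hsum]
  filter_upwards [condExp_add hint herri (MeasurableSpace.comap (trainObs E) inferInstance), hce]
    with ω ha hb
  rw [ha, Pi.add_apply, hb, hmean, add_zero, condExp_of_stronglyMeasurable hle hsm hint]

/-! ### The equivalent channel with known gain -/

/-- Output of the data dimension and channel estimate in terms of independent standard Gaussians
`u` (normalized estimate), `x` (data symbol) and `z` (normalized effective noise), where `a` is the
standard deviation of the estimate and `s` the variance of the estimation error. -/
noncomputable def channelMap (ρ a s : ℝ) (q : ℂ × ℂ × ℂ) : ℂ × ℂ × ℂ :=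
  (q.2.1, ((Real.sqrt ρ * (a * q.1)) * q.2.1
    + (Real.sqrt (1 + ρ * s * ‖q.2.1‖ ^ 2) : ℂ) * q.2.2, a * q.1))

@[fun_prop]
lemma measurable_channelMap (ρ a s : ℝ) : Measurable (channelMap ρ a s) := by
  unfold channelMap; fun_prop

/-- Joint law of data symbol, received symbol and channel estimate. -/
noncomputable def channelLaw (ρ a s : ℝ) : Measure (ℂ × ℂ × ℂ) :=
  (stdCN.prod (stdCN.prod stdCN)).map (channelMap ρ a s)

lemma lintegral_channelLaw (ρ a s : ℝ) {f : ℂ × ℂ × ℂ → ENNReal} (hf : Measurable f) :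
    ∫⁻ q, f q ∂channelLaw ρ a s
      = ∫⁻ u, ∫⁻ x, ∫⁻ z, f (channelMap ρ a s (u, x, z)) ∂stdCN ∂stdCN ∂stdCN := by
  unfold channelLaw
  rw [lintegral_map hf (by fun_prop), lintegral_prod _ (by fun_prop)]
  refine lintegral_congr fun u => ?_
  rw [lintegral_prod _ (by fun_prop)]

/-- Passing from (h, w₀) to the independent pair (estimate, error) leaves, for fixed x, the Gaussian
sum of √ρ x times the error and w. This sum is merged into a single Gaussian of variance 1 + ρ
s|x|². -/
lemma map_sampleLaw_eq_channelLaw {ρ E : ℝ} (hρ : 0 ≤ ρ) (hE : 0 ≤ E) :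
    sampleLaw.map (fun ω => (dataSymbol ω, (dataObs ρ ω, mmseEstimate E ω)))
      = channelLaw ρ (mmseGain E * Real.sqrt (1 + E)) (1 / (1 + E)) := by
  have hcongr : (fun ω => (dataSymbol ω, (dataObs ρ ω, mmseEstimate E ω))) =ᵐ[sampleLaw]
      fun ω => (dataSymbol ω, (dataObs ρ ω, (mmseGain E : ℂ) * trainObs E ω)) := by
    filter_upwards [mmseEstimate_ae_eq hE] with ω hω
    rw [hω]
  rw [Measure.map_congr hcongr]
  refine Measure.ext_of_lintegral _ fun f hf => ?_
  rw [lintegral_map hf (by fun_prop), lintegral_sampleLaw (by fun_prop),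
    lintegral_channelLaw _ _ _ hf]
  have h := lintegral_trainObs hE (f := fun q => ∫⁻ x, ∫⁻ w,
    f (x, ((Real.sqrt ρ : ℂ) * q.2 * x + w, (mmseGain E : ℂ) * q.1)) ∂stdCN ∂stdCN) (by fun_prop)
  refine h.trans (lintegral_congr fun u => ?_)
  rw [lintegral_lintegral_swap (by fun_prop)]
  refine lintegral_congr fun x => ?_
  have h2 := lintegral_stdCN_mul_add ((Real.sqrt ρ : ℂ) * (Real.sqrt (1 / (1 + E)) : ℂ) * x)
    (f := fun t => f (x, ((Real.sqrt ρ : ℂ) * ((mmseGain E : ℂ) * ((Real.sqrt (1 + E) : ℂ) * u)) * x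
      + t, (mmseGain E : ℂ) * ((Real.sqrt (1 + E) : ℂ) * u)))) (by fun_prop)
  have h3 : ‖(Real.sqrt ρ : ℂ) * (Real.sqrt (1 / (1 + E)) : ℂ) * x‖ ^ 2
      = ρ * (1 / (1 + E)) * ‖x‖ ^ 2 := by
    rw [norm_mul, norm_mul, mul_pow, mul_pow, Complex.norm_real, Complex.norm_real,
      Real.norm_eq_abs, Real.norm_eq_abs, sq_abs, sq_abs, Real.sq_sqrt hρ,
      Real.sq_sqrt (by positivity)]
  rw [h3] at h2
  convert h2 using 1
  · refine lintegral_congr fun v => lintegral_congr fun w => ?_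
    ring_nf
  · refine lintegral_congr fun z => ?_
    simp only [channelMap]
    push_cast
    ring_nf

/-- Conditional density of the received symbol given data symbol and channel estimate. -/
noncomputable def channelDensity (ρ s : ℝ) (q : ℂ × ℂ × ℂ) : ℝ :=
  cnDensity (1 + ρ * s * ‖q.1‖ ^ 2) (q.2.1 - (Real.sqrt ρ * q.2.2) * q.1)

@[fun_prop]
lemma measurable_channelDensity (ρ s : ℝ) : Measurable (channelDensity ρ s) := by
  unfold channelDensity; fun_prop

/-- The law of the estimate stays in the reference measure: for a = 0 (no training energy) it is a
point mass and has no Lebesgue density. -/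
lemma channelLaw_eq_withDensity {ρ s : ℝ} (hρ : 0 ≤ ρ) (hs : 0 ≤ s) (a : ℝ) :
    channelLaw ρ a s = (stdCN.prod ((volume : Measure ℂ).prod
      (stdCN.map fun u : ℂ => (a : ℂ) * u))).withDensity
        fun q => ENNReal.ofReal (channelDensity ρ s q) := by
  have hprob : IsProbabilityMeasure (stdCN.map fun u : ℂ => (a : ℂ) * u) :=
    Measure.isProbabilityMeasure_map (by fun_prop)
  refine Measure.ext_of_lintegral _ fun f hf => ?_
  rw [lintegral_channelLaw _ _ _ hf, lintegral_withDensity_eq_lintegral_mul _ (by fun_prop) hf,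
    lintegral_prod _ (by fun_prop)]
  have h1 : ∀ x : ℂ, ∫⁻ q, ((fun q => ENNReal.ofReal (channelDensity ρ s q)) * f) (x, q)
        ∂((volume : Measure ℂ).prod (stdCN.map fun u : ℂ => (a : ℂ) * u))
      = ∫⁻ u, (∫⁻ y, ENNReal.ofReal (channelDensity ρ s (x, y, a * u)) * f (x, y, a * u))
          ∂stdCN := by
    intro x
    rw [lintegral_prod _ (by fun_prop), lintegral_lintegral_swap (by fun_prop),
      lintegral_map (by fun_prop) (by fun_prop)]
    rfl
  simp_rw [h1]
  rw [lintegral_lintegral_swap (by fun_prop)]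
  refine lintegral_congr fun x => lintegral_congr fun u => ?_
  have hv : 0 < 1 + ρ * s * ‖x‖ ^ 2 := by positivity
  have h2 := lintegral_stdCN_affine (f := fun y => f (x, y, a * u)) (by fun_prop)
    ((Real.sqrt ρ * (a * u)) * x) hv
  simp only [channelMap, channelDensity]
  exact h2

/-! ### Taylor bounds for the logarithm and their Gaussian averages -/

lemma sub_sq_div_two_le_log {t : ℝ} (ht : 0 ≤ t) : t - t ^ 2 / 2 ≤ Real.log (1 + t) := by
  refine le_trans ?_ (Real.le_log_one_add_of_nonneg ht)
  rw [le_div_iff₀ (by positivity)]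
  nlinarith [pow_nonneg ht 3]

/-- The difference of the two sides vanishes at 0 and has derivative x³/(1+x) ≥ 0. -/
lemma log_le_cubic {t : ℝ} (ht : 0 ≤ t) : Real.log (1 + t) ≤ t - t ^ 2 / 2 + t ^ 3 / 3 := by
  have hd : ∀ x ∈ Set.Ici (0 : ℝ), HasDerivAt
      (fun x : ℝ => x - x ^ 2 / 2 + x ^ 3 / 3 - Real.log (1 + x)) (x ^ 3 / (1 + x)) x := by
    intro x hx
    have hx' : (0 : ℝ) < 1 + x := by have : (0 : ℝ) ≤ x := hx; positivity
    have h := (((hasDerivAt_id x).sub ((hasDerivAt_pow 2 x).div_const 2)).add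
      ((hasDerivAt_pow 3 x).div_const 3)).sub (((hasDerivAt_id x).const_add 1).log hx'.ne')
    convert! h using 1
    simp only [id]
    field_simp
    ring
  have hm : MonotoneOn (fun x : ℝ => x - x ^ 2 / 2 + x ^ 3 / 3 - Real.log (1 + x))
      (Set.Ici 0) := by
    refine monotoneOn_of_deriv_nonneg (convex_Ici 0)
      (fun x hx => (hd x hx).continuousAt.continuousWithinAt)
      (fun x hx => (hd x (interior_subset hx)).differentiableAt.differentiableWithinAt) ?_
    intro x hx
    have hx0 : (0 : ℝ) ≤ x := interior_subset hx
    rw [(hd x hx0).deriv]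
    positivity
  have := hm (Set.self_mem_Ici) (Set.mem_Ici.2 ht) ht
  simp at this
  linarith

lemma integrable_cubic_stdCN (a b c d : ℝ) : Integrable (fun z : ℂ =>
    a + b * (‖z‖ ^ 2) + c * (‖z‖ ^ 2) ^ 2 + d * (‖z‖ ^ 2) ^ 3) stdCN := by
  have h1 := integrable_norm_pow_stdCN 1
  simp only [pow_one] at h1
  exact (((integrable_const a).add (h1.const_mul b)).add
    ((integrable_norm_pow_stdCN 2).const_mul c)).add ((integrable_norm_pow_stdCN 3).const_mul d)

lemma integral_cubic_stdCN (a b c d : ℝ) : ∫ z : ℂ,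
    (a + b * (‖z‖ ^ 2) + c * (‖z‖ ^ 2) ^ 2 + d * (‖z‖ ^ 2) ^ 3) ∂stdCN
      = a + b + 2 * c + 6 * d := by
  have h1 := integrable_norm_pow_stdCN 1
  have h1' := integral_norm_pow_stdCN 1
  simp only [pow_one] at h1 h1'
  have h2 := integrable_norm_pow_stdCN 2
  have h3 := integrable_norm_pow_stdCN 3
  rw [integral_add (by fun_prop) (by fun_prop), integral_add (by fun_prop) (by fun_prop),
    integral_add (by fun_prop) (by fun_prop), integral_const_mul, integral_const_mul,
    integral_const_mul, h1', integral_norm_pow_stdCN, integral_norm_pow_stdCN]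
  simp [Nat.factorial]
  ring

lemma integrable_log_stdCN {v b : ℝ} (hv : 1 ≤ v) (hb : 0 ≤ b) :
    Integrable (fun z : ℂ => Real.log (v + b * ‖z‖ ^ 2)) stdCN := by
  refine Integrable.mono' (integrable_cubic_stdCN (v - 1) b 0 0)
    (by apply Measurable.aestronglyMeasurable; fun_prop) (ae_of_all _ fun z => ?_)
  have h1 : 1 ≤ v + b * ‖z‖ ^ 2 := by nlinarith [mul_nonneg hb (sq_nonneg ‖z‖)]
  rw [Real.norm_eq_abs, abs_of_nonneg (Real.log_nonneg h1)]
  have := Real.log_le_sub_one_of_pos (lt_of_lt_of_le one_pos h1)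
  linarith

lemma integral_log_stdCN_le_cubic {c b : ℝ} (hc : 0 ≤ c) (hb : 0 ≤ b) :
    ∫ z, Real.log (1 + c + b * ‖z‖ ^ 2) ∂stdCN
      ≤ (c + b) - (c ^ 2 + 2 * c * b + 2 * b ^ 2) / 2
        + (c ^ 3 + 3 * c ^ 2 * b + 6 * c * b ^ 2 + 6 * b ^ 3) / 3 := by
  have h := integral_mono (integrable_log_stdCN (v := 1 + c) (b := b) (by linarith) hb)
    (integrable_cubic_stdCN (c - c ^ 2 / 2 + c ^ 3 / 3) (b - c * b + c ^ 2 * b)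
      (-b ^ 2 / 2 + c * b ^ 2) (b ^ 3 / 3)) (fun z => by
        have := log_le_cubic (t := c + b * ‖z‖ ^ 2) (by positivity)
        dsimp only
        rw [add_assoc]
        refine this.trans (le_of_eq ?_)
        ring)
  rw [integral_cubic_stdCN] at h
  linarith

lemma quadratic_le_integral_log_stdCN {b : ℝ} (hb : 0 ≤ b) :
    b - b ^ 2 ≤ ∫ z, Real.log (1 + b * ‖z‖ ^ 2) ∂stdCN := by
  have h := integral_mono (integrable_cubic_stdCN 0 b (-b ^ 2 / 2) 0)
    (integrable_log_stdCN (v := 1) (b := b) le_rfl hb) (fun z => by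
        have := sub_sq_div_two_le_log (t := b * ‖z‖ ^ 2) (by positivity)
        dsimp only
        refine le_trans (le_of_eq ?_) this
        ring)
  rw [integral_cubic_stdCN] at h
  linarith

/-! ### Entropy bounds for the equivalent channel -/

lemma lintegral_norm_sq_affine (m : ℂ) (σ : ℝ) :
    ∫⁻ z, ENNReal.ofReal (‖m + (σ : ℂ) * z‖ ^ 2) ∂stdCN = ENNReal.ofReal (‖m‖ ^ 2 + σ ^ 2) := by
  have hexp : ∀ z : ℂ, ‖m + (σ : ℂ) * z‖ ^ 2
      = (‖m‖ ^ 2 + σ ^ 2 * ‖z‖ ^ 2) + 2 * σ * (starRingEnd ℂ m * z).re := by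
    intro z
    simp only [Complex.sq_norm, Complex.normSq_apply, Complex.add_re, Complex.add_im,
      Complex.mul_re, Complex.mul_im, Complex.conj_re, Complex.conj_im, Complex.ofReal_re,
      Complex.ofReal_im]
    ring
  have hi := integrable_norm_pow_stdCN 1
  have hi' := integral_norm_pow_stdCN 1
  simp only [pow_one] at hi hi'
  have hmz : Integrable (fun z : ℂ => starRingEnd ℂ m * z) stdCN :=
    integrable_id_stdCN.const_mul _
  have hre : Integrable (fun z : ℂ => (starRingEnd ℂ m * z).re) stdCN := hmz.re
  have hre0 : ∫ z : ℂ, (starRingEnd ℂ m * z).re ∂stdCN = 0 := by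
    have h := integral_re (𝕜 := ℂ) hmz
    rw [integral_const_mul, integral_id_stdCN, mul_zero] at h
    simpa using h
  have hint : Integrable (fun z : ℂ => ‖m + (σ : ℂ) * z‖ ^ 2) stdCN := by
    simp_rw [hexp]
    fun_prop
  rw [← ofReal_integral_eq_lintegral_ofReal hint (ae_of_all _ fun _ => by positivity)]
  congr 1
  simp_rw [hexp]
  rw [integral_add (by fun_prop) (by fun_prop), integral_add (by fun_prop) (by fun_prop),
    integral_const_mul, integral_const_mul, hre0, hi']
  simp

lemma cnDensity_le_one {v : ℝ} (hv : 1 ≤ v) (z : ℂ) : cnDensity v z ≤ 1 := by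
  have hpi : 1 ≤ Real.pi := by linarith [Real.pi_gt_three]
  unfold cnDensity
  refine mul_le_one₀ (inv_le_one_of_one_le₀ (by nlinarith)) (Real.exp_pos _).le ?_
  rw [Real.exp_le_one_iff, neg_nonpos]
  positivity

/-- Bounds for the mutual information between the data symbol and the detector input, given as
differences of (conditional) differential entropies. -/
theorem channelLaw_information_bounds {ρ a s : ℝ} (hρ : 0 ≤ ρ) (hs : 0 ≤ s) :
    (InformationTheory.klDiv (channelLaw ρ a s) (((channelLaw ρ a s).map Prod.fst).prod
        ((channelLaw ρ a s).map Prod.snd))).toReal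
      ≤ ∫ u, Real.log (1 + ρ * s + ρ * a ^ 2 * ‖u‖ ^ 2) ∂stdCN
        - ∫ x, Real.log (1 + ρ * s * ‖x‖ ^ 2) ∂stdCN ∧
    ∫ u, Real.log (1 + ρ * s + ρ * a ^ 2 * ‖u‖ ^ 2) ∂stdCN - Real.log (1 + ρ * s)
      ≤ (InformationTheory.klDiv (channelLaw ρ a s) (((channelLaw ρ a s).map Prod.fst).prod
        ((channelLaw ρ a s).map Prod.snd))).toReal := by
  have hprob : IsProbabilityMeasure (stdCN.map fun u : ℂ => (a : ℂ) * u) :=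
    Measure.isProbabilityMeasure_map (by fun_prop)
  have hρs : 0 ≤ ρ * s := by positivity
  have hm : ∀ x : ℂ, ‖(Real.sqrt ρ : ℂ) * x‖ ^ 2 = ρ * ‖x‖ ^ 2 := by
    intro x
    rw [norm_mul, mul_pow, Complex.norm_real, Real.norm_eq_abs, sq_abs, Real.sq_sqrt hρ]
  have ha : ∀ x : ℂ, ‖(a : ℂ) * x‖ ^ 2 = a ^ 2 * ‖x‖ ^ 2 := by
    intro x
    rw [norm_mul, mul_pow, Complex.norm_real, Real.norm_eq_abs, sq_abs]
  have hσ : ∀ x z : ℂ, ‖(Real.sqrt (1 + ρ * s * ‖x‖ ^ 2) : ℂ) * z‖ ^ 2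
      = (1 + ρ * s * ‖x‖ ^ 2) * ‖z‖ ^ 2 := by
    intro x z
    rw [norm_mul, mul_pow, Complex.norm_real, Real.norm_eq_abs, sq_abs,
      Real.sq_sqrt (by positivity)]
  -- r is Gaussian with the true conditional second moment of y given the estimate. f is the
  -- likelihood of a detector that replaces the noise variance 1 + ρ s|x|² by its mean; averaging f
  -- over x gives exactly r.
  set r : ℂ × ℂ → ℝ := fun q => cnDensity (1 + ρ * s + ρ * ‖q.2‖ ^ 2) q.1 with hr
  set f : ℂ × ℂ × ℂ → ℝ := fun q =>
    cnDensity (1 + ρ * s) (q.2.1 - (Real.sqrt ρ * q.2.2) * q.1) with hf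
  set B : Measure (ℂ × ℂ × ℂ) := stdCN.prod (stdCN.prod stdCN) with hB
  -- the three log-densities along the channel
  have hlp : ∀ q, Real.log (channelDensity ρ s (channelMap ρ a s q))
      = -Real.log Real.pi - Real.log (1 + ρ * s * ‖q.2.1‖ ^ 2) - ‖q.2.2‖ ^ 2 := by
    intro q
    have hpos : 0 < 1 + ρ * s * ‖q.2.1‖ ^ 2 := by positivity
    rw [channelDensity, log_cnDensity (by simp only [channelMap]; positivity)]
    simp only [channelMap, add_sub_cancel_left]
    rw [hσ, mul_div_cancel_left₀ _ hpos.ne']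
  have hlf : ∀ q, Real.log (f (channelMap ρ a s q))
      = -Real.log Real.pi - Real.log (1 + ρ * s)
        - ((1 + ρ * s * ‖q.2.1‖ ^ 2) * ‖q.2.2‖ ^ 2) / (1 + ρ * s) := by
    intro q
    simp only [hf]
    rw [log_cnDensity (by positivity)]
    simp only [channelMap, add_sub_cancel_left]
    rw [hσ]
  have hlr : ∀ q, Real.log (r (channelMap ρ a s q).2)
      = -Real.log Real.pi - Real.log (1 + ρ * s + ρ * a ^ 2 * ‖q.1‖ ^ 2)
        - ‖(channelMap ρ a s q).2.1‖ ^ 2 / (1 + ρ * s + ρ * a ^ 2 * ‖q.1‖ ^ 2) := by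
    intro q
    simp only [hr]
    have h1 : ‖(channelMap ρ a s q).2.2‖ ^ 2 = a ^ 2 * ‖q.1‖ ^ 2 := ha _
    rw [h1, log_cnDensity (by positivity), mul_assoc]
  -- integrability and integrals of the pieces
  have hi := integrable_norm_pow_stdCN 1
  have hi' := integral_norm_pow_stdCN 1
  simp only [pow_one, Nat.factorial_one, Nat.cast_one] at hi hi'
  have hzi : Integrable (fun q : ℂ × ℂ × ℂ => ‖q.2.2‖ ^ 2) B :=
    (hi.comp_snd stdCN).comp_snd stdCN
  have hz1 : ∫ q, ‖q.2.2‖ ^ 2 ∂B = 1 := by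
    have h1 := integral_fun_snd (μ := stdCN) (ν := stdCN.prod stdCN)
      (fun q : ℂ × ℂ => ‖q.2‖ ^ 2)
    have h2 := integral_fun_snd (μ := stdCN) (ν := stdCN) (fun q : ℂ => ‖q‖ ^ 2)
    simp only [probReal_univ, one_smul] at h1 h2
    rw [hB, h1, h2, hi']
  have hxi : Integrable (fun q : ℂ × ℂ × ℂ => Real.log (1 + ρ * s * ‖q.2.1‖ ^ 2)) B :=
    ((integrable_log_stdCN le_rfl hρs).comp_fst stdCN).comp_snd stdCN
  have hx1 : ∫ q, Real.log (1 + ρ * s * ‖q.2.1‖ ^ 2) ∂B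
      = ∫ x, Real.log (1 + ρ * s * ‖x‖ ^ 2) ∂stdCN := by
    have h1 := integral_fun_snd (μ := stdCN) (ν := stdCN.prod stdCN)
      (fun q : ℂ × ℂ => Real.log (1 + ρ * s * ‖q.1‖ ^ 2))
    have h2 := integral_fun_fst (μ := stdCN) (ν := stdCN)
      (fun q : ℂ => Real.log (1 + ρ * s * ‖q‖ ^ 2))
    simp only [probReal_univ, one_smul] at h1 h2
    rw [hB, h1, h2]
  have hui : Integrable (fun q : ℂ × ℂ × ℂ =>
      Real.log (1 + ρ * s + ρ * a ^ 2 * ‖q.1‖ ^ 2)) B :=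
    (integrable_log_stdCN (by linarith) (by positivity)).comp_fst _
  have hu1 : ∫ q, Real.log (1 + ρ * s + ρ * a ^ 2 * ‖q.1‖ ^ 2) ∂B
      = ∫ u, Real.log (1 + ρ * s + ρ * a ^ 2 * ‖u‖ ^ 2) ∂stdCN := by
    have h1 := integral_fun_fst (μ := stdCN) (ν := stdCN.prod stdCN)
      (fun q : ℂ => Real.log (1 + ρ * s + ρ * a ^ 2 * ‖q‖ ^ 2))
    simp only [probReal_univ, one_smul] at h1
    rw [hB, h1]
  have hnx : Integrable (fun x : ℂ => 1 + ρ * s * ‖x‖ ^ 2) stdCN := by fun_prop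
  have hnx1 : ∫ x : ℂ, (1 + ρ * s * ‖x‖ ^ 2) ∂stdCN = 1 + ρ * s := by
    rw [integral_add (by fun_prop) (by fun_prop), integral_const_mul, hi']; simp
  have hni : Integrable (fun q : ℂ × ℂ × ℂ =>
      ((1 + ρ * s * ‖q.2.1‖ ^ 2) * ‖q.2.2‖ ^ 2) / (1 + ρ * s)) B :=
    ((hnx.mul_prod hi).comp_snd stdCN).div_const _
  have hn1 : ∫ q : ℂ × ℂ × ℂ, ((1 + ρ * s * ‖q.2.1‖ ^ 2) * ‖q.2.2‖ ^ 2) / (1 + ρ * s) ∂B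
      = 1 := by
    have h1 := integral_fun_snd (μ := stdCN) (ν := stdCN.prod stdCN)
      (fun q : ℂ × ℂ => (1 + ρ * s * ‖q.1‖ ^ 2) * ‖q.2‖ ^ 2)
    have h2 := integral_prod_mul (μ := stdCN) (ν := stdCN)
      (fun x : ℂ => 1 + ρ * s * ‖x‖ ^ 2) (fun z : ℂ => ‖z‖ ^ 2)
    simp only [probReal_univ, one_smul] at h1
    rw [integral_div, hB, h1, h2, hnx1, hi', mul_one, div_self (by positivity)]
  -- The variance of r matches the second moment of y, so the normalized quadratic form has mean
  -- one, as in `hz1` and `hn1`. The three −1's then cancel in the entropy differences.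
  have hyl : ∫⁻ q, ENNReal.ofReal (‖(channelMap ρ a s q).2.1‖ ^ 2
      / (1 + ρ * s + ρ * a ^ 2 * ‖q.1‖ ^ 2)) ∂B = 1 := by
    have hmeas : Measurable fun q : ℂ × ℂ × ℂ => ‖(channelMap ρ a s q).2.1‖ ^ 2 := by fun_prop
    rw [hB, lintegral_prod _ (by fun_prop)]
    have h1 : ∀ u : ℂ, ∫⁻ q, ENNReal.ofReal (‖(channelMap ρ a s (u, q)).2.1‖ ^ 2
      / (1 + ρ * s + ρ * a ^ 2 * ‖u‖ ^ 2)) ∂(stdCN.prod stdCN) = 1 := by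
      intro u
      have hD : 0 < 1 + ρ * s + ρ * a ^ 2 * ‖u‖ ^ 2 := by positivity
      simp_rw [ENNReal.ofReal_div_of_pos hD, div_eq_mul_inv]
      rw [lintegral_mul_const _ (by fun_prop), lintegral_prod _ (by fun_prop)]
      have h2 : ∀ x : ℂ, ∫⁻ z, ENNReal.ofReal (‖(channelMap ρ a s (u, x, z)).2.1‖ ^ 2) ∂stdCN
          = ENNReal.ofReal (1 + (ρ * s + ρ * a ^ 2 * ‖u‖ ^ 2) * ‖x‖ ^ 2) := by
        intro x
        have h3 := lintegral_norm_sq_affine ((Real.sqrt ρ * (a * u)) * x)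
          (Real.sqrt (1 + ρ * s * ‖x‖ ^ 2))
        refine h3.trans ?_
        rw [norm_mul, mul_pow, hm, ha, Real.sq_sqrt (by positivity)]
        congr 1
        ring
      simp_rw [h2]
      rw [← ofReal_integral_eq_lintegral_ofReal (by fun_prop)
        (ae_of_all _ fun x => by positivity), integral_add (by fun_prop) (by fun_prop),
        integral_const_mul, hi']
      simp only [integral_const, probReal_univ, smul_eq_mul, mul_one]
      rw [← add_assoc]
      exact ENNReal.mul_inv_cancel (by simpa using hD) ENNReal.ofReal_ne_top
    simp_rw [h1]
    simp
  have hym : Measurable fun q : ℂ × ℂ × ℂ => ‖(channelMap ρ a s q).2.1‖ ^ 2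
      / (1 + ρ * s + ρ * a ^ 2 * ‖q.1‖ ^ 2) := by fun_prop
  have hy0 : ∀ q : ℂ × ℂ × ℂ, 0 ≤ ‖(channelMap ρ a s q).2.1‖ ^ 2
      / (1 + ρ * s + ρ * a ^ 2 * ‖q.1‖ ^ 2) := fun q => by positivity
  have hyi := (integrable_and_integral_le_one_of_lintegral_le_one hym hy0 hyl.le).1
  have hy1 : ∫ q, ‖(channelMap ρ a s q).2.1‖ ^ 2
      / (1 + ρ * s + ρ * a ^ 2 * ‖q.1‖ ^ 2) ∂B = 1 := by
    rw [integral_eq_lintegral_of_nonneg_ae (ae_of_all _ hy0) hym.aestronglyMeasurable, hyl]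
    simp
  have hrm : Measurable r := by rw [hr]; fun_prop
  have hfm : Measurable f := by rw [hf]; fun_prop
  have hTm := measurable_channelMap ρ a s
  have hpl : Measurable fun q => Real.log (channelDensity ρ s q) := by fun_prop
  have hrl : Measurable fun q : ℂ × ℂ × ℂ => Real.log (r q.2) := by fun_prop
  have hfl : Measurable fun q => Real.log (f q) := by fun_prop
  have key := klDiv_prod_marginals_bounds (γ := stdCN)
    (lam := (volume : Measure ℂ).prod (stdCN.map fun u : ℂ => (a : ℂ) * u))
    (p := channelDensity ρ s) (P := channelLaw ρ a s) (r := r) (f := f)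
    (by fun_prop) (fun q => cnDensity_pos (by positivity) _)
    (fun q => cnDensity_le_one (by nlinarith [mul_nonneg hρs (sq_nonneg ‖q.1‖)]) _)
    (fun x => by
      rw [lintegral_prod _ (by fun_prop), lintegral_lintegral_swap (by fun_prop)]
      simp only [channelDensity]
      simp_rw [lintegral_cnDensity_sub _ (show 0 < 1 + ρ * s * ‖x‖ ^ 2 by positivity)]
      simp)
    (channelLaw_eq_withDensity hρ hs a)
    (by
      rw [channelLaw, integrable_map_measure hpl.aestronglyMeasurable hTm.aemeasurable]
      refine (((integrable_const _).sub hxi).sub hzi).congr (ae_of_all _ fun q => (hlp q).symm))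
    hrm (fun q => cnDensity_pos (by positivity) _)
    (by
      rw [lintegral_prod _ (by fun_prop), lintegral_lintegral_swap (by fun_prop)]
      have h1 : ∀ w : ℂ, ∫⁻ y, ENNReal.ofReal (r (y, w)) = 1 := by
        intro w
        simpa using lintegral_cnDensity_sub 0 (show 0 < 1 + ρ * s + ρ * ‖w‖ ^ 2 by positivity)
      simp_rw [h1]
      simp)
    (by
      rw [channelLaw, integrable_map_measure hrl.aestronglyMeasurable hTm.aemeasurable]
      refine (((integrable_const _).sub hui).sub hyi).congr (ae_of_all _ fun q => (hlr q).symm))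
    hfm (fun q => cnDensity_pos (by positivity) _)
    (fun q => by
      have h1 := lintegral_cnDensity_sub_mul (Real.sqrt ρ * q.2) q.1
        (show 0 < 1 + ρ * s by positivity)
      rwa [hm] at h1)
    (by
      rw [channelLaw, integrable_map_measure hfl.aestronglyMeasurable hTm.aemeasurable]
      refine (((integrable_const _).sub (integrable_const _)).sub hni).congr
        (ae_of_all _ fun q => (hlf q).symm))
  have hIp : ∫ q, Real.log (channelDensity ρ s q) ∂channelLaw ρ a s
      = -Real.log Real.pi - ∫ x, Real.log (1 + ρ * s * ‖x‖ ^ 2) ∂stdCN - 1 := by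
    rw [channelLaw, integral_map hTm.aemeasurable hpl.aestronglyMeasurable]
    simp_rw [hlp]
    rw [← hB, integral_sub (by fun_prop) hzi, integral_sub (integrable_const _) hxi,
      hz1, hx1]
    simp
  have hIr : ∫ q, Real.log (r q.2) ∂channelLaw ρ a s
      = -Real.log Real.pi - ∫ u, Real.log (1 + ρ * s + ρ * a ^ 2 * ‖u‖ ^ 2) ∂stdCN - 1 := by
    rw [channelLaw, integral_map hTm.aemeasurable hrl.aestronglyMeasurable]
    simp_rw [hlr]
    rw [← hB, integral_sub (by fun_prop) hyi, integral_sub (integrable_const _) hui,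
      hy1, hu1]
    simp
  have hIf : ∫ q, Real.log (f q) ∂channelLaw ρ a s
      = -Real.log Real.pi - Real.log (1 + ρ * s) - 1 := by
    rw [channelLaw, integral_map hTm.aemeasurable hfl.aestronglyMeasurable]
    simp_rw [hlf]
    rw [← hB, integral_sub (by fun_prop) hni, hn1]
    simp
  rw [hIp, hIr, hIf] at key
  constructor
  · linarith [key.1]
  · linarith [key.2]

/-! ### Second-order expansion of the information per data symbol -/

lemma measurable_mmseEstimate (E : ℝ) : Measurable (mmseEstimate E) :=
  (stronglyMeasurable_condExp.mono (measurable_trainObs E).comap_le).measurable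

lemma mutualInfo_eq_klDiv_channelLaw {ρ E : ℝ} (hρ : 0 ≤ ρ) (hE : 0 ≤ E) :
    mutualInfo sampleLaw dataSymbol (fun ω => (dataObs ρ ω, mmseEstimate E ω))
      = InformationTheory.klDiv (channelLaw ρ (mmseGain E * Real.sqrt (1 + E)) (1 / (1 + E)))
        (((channelLaw ρ (mmseGain E * Real.sqrt (1 + E)) (1 / (1 + E))).map Prod.fst).prod
          ((channelLaw ρ (mmseGain E * Real.sqrt (1 + E)) (1 / (1 + E))).map Prod.snd)) := by
  have hm := measurable_mmseEstimate E
  rw [mutualInfo, ← map_sampleLaw_eq_channelLaw hρ hE,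
    Measure.map_map measurable_fst (by fun_prop), Measure.map_map measurable_snd (by fun_prop)]
  rfl

lemma mmseGain_mul_sqrt_sq {E : ℝ} (hE : 0 ≤ E) :
    (mmseGain E * Real.sqrt (1 + E)) ^ 2 = 1 - 1 / (1 + E) := by
  have h : (0 : ℝ) < 1 + E := by positivity
  rw [mmseGain, mul_pow, div_pow, Real.sq_sqrt hE, Real.sq_sqrt h.le]
  field_simp
  ring

/-- Second-order expansion of the information per data symbol, from above. -/
lemma mutualInfo_le {ρ E : ℝ} (hρ : 0 ≤ ρ) (hE : 0 ≤ E) :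
    (mutualInfo sampleLaw dataSymbol (fun ω => (dataObs ρ ω, mmseEstimate E ω))).toReal
      ≤ ρ * (1 - 1 / (1 + E)) - ρ ^ 2 * (1 - 3 / 2 * (1 / (1 + E))) + 2 * ρ ^ 3 := by
  rw [mutualInfo_eq_klDiv_channelLaw hρ hE]
  have hs0 : 0 ≤ 1 / (1 + E) := by positivity
  have hs1 : 1 / (1 + E) ≤ 1 := by rw [div_le_one (by positivity)]; linarith
  have h := (channelLaw_information_bounds (a := mmseGain E * Real.sqrt (1 + E)) hρ hs0).1
  rw [mmseGain_mul_sqrt_sq hE] at h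
  set s := 1 / (1 + E)
  have hs1' : 0 ≤ 1 - s := by linarith
  refine h.trans ?_
  have h1 := integral_log_stdCN_le_cubic (c := ρ * s) (b := ρ * (1 - s)) (by positivity)
    (by positivity)
  have h2 := quadratic_le_integral_log_stdCN (b := ρ * s) (by positivity)
  have h3 : ((ρ * s) ^ 3 + 3 * (ρ * s) ^ 2 * (ρ * (1 - s)) + 6 * (ρ * s) * (ρ * (1 - s)) ^ 2
      + 6 * (ρ * (1 - s)) ^ 3) / 3 ≤ 2 * ρ ^ 3 := by
    have : s ^ 3 + 3 * s ^ 2 * (1 - s) + 6 * s * (1 - s) ^ 2 + 6 * (1 - s) ^ 3 ≤ 6 := by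
      nlinarith [mul_nonneg hs0 hs1', mul_nonneg (mul_nonneg hs0 hs0) hs1',
        mul_nonneg (mul_nonneg hs0 hs1') hs1', pow_nonneg hs0 3]
    nlinarith [mul_le_mul_of_nonneg_left this (pow_nonneg hρ 3)]
  -- The exact quadratic coefficient is 1 − s − s²/2; s² ≤ s weakens it to 1 − 3s/2.
  have h4 : ρ ^ 2 * s ^ 2 ≤ ρ ^ 2 * s :=
    mul_le_mul_of_nonneg_left (by nlinarith) (sq_nonneg ρ)
  nlinarith

/-- Second-order expansion of the information per data symbol, from below. -/
lemma le_mutualInfo {ρ E : ℝ} (hρ : 0 ≤ ρ) (hE : 0 ≤ E) :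
    ρ * (1 - 1 / (1 + E)) - ρ ^ 2 * (1 + 1 / (1 + E)) ≤
    (mutualInfo sampleLaw dataSymbol (fun ω => (dataObs ρ ω, mmseEstimate E ω))).toReal := by
  rw [mutualInfo_eq_klDiv_channelLaw hρ hE]
  have hs0 : 0 ≤ 1 / (1 + E) := by positivity
  have hs1 : 1 / (1 + E) ≤ 1 := by rw [div_le_one (by positivity)]; linarith
  have h := (channelLaw_information_bounds (a := mmseGain E * Real.sqrt (1 + E)) hρ hs0).2
  rw [mmseGain_mul_sqrt_sq hE] at h
  set s := 1 / (1 + E)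
  have hs1' : 0 ≤ 1 - s := by linarith
  refine le_trans ?_ h
  have hd : 0 < 1 + ρ * s := by positivity
  -- b is the effective signal-to-noise ratio, with the estimation error counted as noise.
  set b := ρ * (1 - s) / (1 + ρ * s) with hb
  have hb0 : 0 ≤ b := by positivity
  have h1 : ∫ u : ℂ, Real.log (1 + ρ * s + ρ * (1 - s) * ‖u‖ ^ 2) ∂stdCN - Real.log (1 + ρ * s)
      = ∫ u : ℂ, Real.log (1 + b * ‖u‖ ^ 2) ∂stdCN := by
    have h2 : ∀ u : ℂ, Real.log (1 + ρ * s + ρ * (1 - s) * ‖u‖ ^ 2)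
        = Real.log (1 + ρ * s) + Real.log (1 + b * ‖u‖ ^ 2) := by
      intro u
      rw [← Real.log_mul hd.ne' (by positivity), hb]
      congr 1
      field_simp
    have h3 := integrable_log_stdCN (v := 1) (b := b) le_rfl hb0
    simp_rw [h2]
    rw [integral_add (integrable_const _) h3]
    simp
  rw [h1]
  refine le_trans ?_ (quadratic_le_integral_log_stdCN hb0)
  have hb1 : b ≤ ρ := by
    rw [hb, div_le_iff₀ hd]
    nlinarith [mul_nonneg (mul_nonneg hρ hρ) hs0, mul_nonneg hρ hs0]
  have hb2 : ρ * (1 - s) - ρ ^ 2 * s ≤ b := by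
    rw [hb, le_div_iff₀ hd]
    have e : (ρ * (1 - s) - ρ ^ 2 * s) * (1 + ρ * s)
      = ρ * (1 - s) - (ρ ^ 2 * s ^ 2 + ρ ^ 3 * s ^ 2) := by ring
    rw [e]
    have : 0 ≤ ρ ^ 2 * s ^ 2 + ρ ^ 3 * s ^ 2 := by positivity
    linarith
  nlinarith

/-! ### Energy loss and rate for a given split -/

/-- Training and estimation together lose at least the fraction `1 / (1 + √A)` of the energy `A`
of a coherence subspace. -/
lemma training_loss {A η : ℝ} (hA : 0 < A) (hη0 : 0 ≤ η) (hη1 : η ≤ 1) :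
    1 / (1 + Real.sqrt A) ≤ 1 - (1 - η) * (1 - 1 / (1 + η * A)) := by
  have hsq := Real.mul_self_sqrt hA.le
  have hr := Real.sqrt_pos.2 hA
  set t := Real.sqrt A
  have hs0 : 0 < 1 / (1 + η * A) := by positivity
  have hs1 : 1 / (1 + η * A) ≤ 1 := by
    rw [div_le_one (by positivity)]; nlinarith [mul_nonneg hη0 hA.le]
  -- The loss is at least max(η, 1/(1+ηA)). If η ≤ 1/√A then ηA ≤ √A and the estimation term
  -- suffices; otherwise η alone exceeds 1/√A.
  by_cases h : η * t ≤ 1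
  · have h1 : 1 / (1 + t) ≤ 1 / (1 + η * A) := by
      apply one_div_le_one_div_of_le (by positivity)
      nlinarith
    nlinarith
  · have h1 : 1 / (1 + t) ≤ η := by
      rw [div_le_iff₀ (by positivity)]
      nlinarith
    nlinarith

lemma trainingRate_nonneg {Nc snr η : ℝ} (hN : 1 ≤ Nc) : 0 ≤ trainingRate Nc snr η := by
  have : 0 ≤ Nc - 1 := by linarith
  have : 0 ≤ Real.log 2 := Real.log_nonneg (by norm_num)
  unfold trainingRate
  positivity

lemma trainingRate_mul_log_two (Nc snr η : ℝ) : trainingRate Nc snr η * Real.log 2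
    = (Nc - 1) / Nc * (mutualInfo sampleLaw dataSymbol
        (fun ω => (dataObs ((1 - η) * Nc * snr / (Nc - 1)) ω,
          mmseEstimate (η * Nc * snr) ω))).toReal := by
  have : Real.log 2 ≠ 0 := (Real.log_pos (by norm_num)).ne'
  unfold trainingRate
  field_simp

/-- The loss fraction L dominates both η and s. The corrections to −SNR² are at most 2η SNR² + 3s
SNR² ≤ 5L SNR², which for SNR ≤ 1/10 is at most half of the first-order loss SNR·L. The cubic term
gives 2·SNR·(2 SNR)² = 8 SNR³. -/
lemma information_quadratic_bound {snr η s g ρ : ℝ} (hsnr : 0 < snr) (hsnr' : snr ≤ 1 / 10)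
    (hη0 : 0 ≤ η) (hη1 : η ≤ 1) (hs0 : 0 ≤ s) (hs1 : s ≤ 1) (hg1 : g ≤ 1) (hg2 : 1 / 2 ≤ g)
    (hρ0 : 0 ≤ ρ) (hgρ : g * ρ = (1 - η) * snr) :
    g * (ρ * (1 - s) - ρ ^ 2 * (1 - 3 / 2 * s) + 2 * ρ ^ 3)
      ≤ snr - snr ^ 2 - snr * (1 - (1 - η) * (1 - s)) / 2 + 8 * snr ^ 3 := by
  obtain ⟨d, hd⟩ : ∃ d, d = (1 - η) * snr := ⟨_, rfl⟩
  obtain ⟨L, hL⟩ : ∃ L, L = 1 - (1 - η) * (1 - s) := ⟨_, rfl⟩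
  rw [← hd] at hgρ
  have hd0 : 0 ≤ d := by rw [hd]; exact mul_nonneg (by linarith) hsnr.le
  have hd1 : d ≤ snr := by rw [hd]; linarith [mul_nonneg hη0 hsnr.le]
  have hρ2 : ρ ≤ 2 * d := by linarith [mul_le_mul_of_nonneg_right hg2 hρ0]
  have hdρ : d ≤ ρ := by linarith [mul_le_mul_of_nonneg_right hg1 hρ0]
  have hρ3 : ρ ≤ 2 * snr := by linarith
  have e1 : g * (ρ * (1 - s) - ρ ^ 2 * (1 - 3 / 2 * s) + 2 * ρ ^ 3)
      = d * (1 - s) - d * ρ + 3 / 2 * (s * (d * ρ)) + 2 * (d * ρ ^ 2) := by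
    rw [← hgρ]; ring
  have b1 : d ^ 2 ≤ d * ρ := by rw [sq]; gcongr
  have b2 : d * ρ ≤ snr * (2 * snr) := by gcongr
  have b3 : s * (d * ρ) ≤ s * (snr * (2 * snr)) := mul_le_mul_of_nonneg_left b2 hs0
  have b4 : d * ρ ^ 2 ≤ snr * (2 * snr) ^ 2 := by gcongr
  have hL1 : η ≤ L := by rw [hL]; nlinarith
  have hL2 : s ≤ L := by rw [hL]; nlinarith
  have e2 : d * (1 - s) = snr - snr * L := by rw [hd, hL]; ring
  have e3 : d ^ 2 = snr ^ 2 - 2 * (η * snr ^ 2) + η ^ 2 * snr ^ 2 := by rw [hd]; ring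
  have e4 : 0 ≤ η ^ 2 * snr ^ 2 := by positivity
  have b5 : η * snr ^ 2 ≤ L * snr ^ 2 := by gcongr
  have b6 : s * snr ^ 2 ≤ L * snr ^ 2 := by gcongr
  have hL0 : 0 ≤ L := hη0.trans hL1
  have b7 : (L * snr) * snr ≤ (L * snr) * (1 / 10) := by gcongr
  rw [e1, ← hL]
  linarith

lemma trainingRate_mul_log_two_le {Nc snr η : ℝ} (hN : 2 ≤ Nc) (hsnr : 0 < snr)
    (hsnr' : snr ≤ 1 / 10) (hη0 : 0 ≤ η) (hη1 : η ≤ 1) :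
    trainingRate Nc snr η * Real.log 2
      ≤ snr - snr ^ 2 - snr / (2 * (1 + Real.sqrt (Nc * snr))) + 8 * snr ^ 3 := by
  have hN1 : 0 < Nc - 1 := by linarith
  have hN0 : 0 < Nc := by linarith
  have hη1' : 0 ≤ 1 - η := by linarith
  have hE0 : 0 ≤ η * Nc * snr := by positivity
  have hρ0 : 0 ≤ (1 - η) * Nc * snr / (Nc - 1) := by positivity
  have hloss := training_loss (show 0 < Nc * snr by positivity) hη0 hη1
  rw [← mul_assoc] at hloss
  have hs1 : 1 / (1 + η * Nc * snr) ≤ 1 := by rw [div_le_one (by positivity)]; linarith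
  have hbound := information_quadratic_bound (g := (Nc - 1) / Nc) hsnr hsnr' hη0 hη1
    (show 0 ≤ 1 / (1 + η * Nc * snr) by positivity) hs1 (by rw [div_le_one hN0]; linarith)
    (by rw [div_le_div_iff₀ (by norm_num) hN0]; linarith) hρ0 (by field_simp)
  rw [trainingRate_mul_log_two]
  refine (mul_le_mul_of_nonneg_left (mutualInfo_le hρ0 hE0) (by positivity)).trans
    (hbound.trans ?_)
  have e : snr / (2 * (1 + Real.sqrt (Nc * snr)))
      = snr * (1 / (1 + Real.sqrt (Nc * snr))) / 2 := by field_simp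
  have b := mul_le_mul_of_nonneg_left hloss hsnr.le
  rw [e]
  linarith

lemma le_trainingRate_mul_log_two {Nc snr η : ℝ} (hN : 2 ≤ Nc) (hsnr : 0 < snr)
    (hη0 : 0 ≤ η) (hη1 : η ≤ 1) :
    snr - snr ^ 2 - (η + 1 / (1 + η * Nc * snr)) * snr - 2 * snr ^ 2 / Nc
        - 2 * (1 / (1 + η * Nc * snr)) * snr ^ 2
      ≤ trainingRate Nc snr η * Real.log 2 := by
  have hN1 : 0 < Nc - 1 := by linarith
  have hN0 : 0 < Nc := by linarith
  have hη1' : 0 ≤ 1 - η := by linarith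
  rw [trainingRate_mul_log_two]
  have hE0 : 0 ≤ η * Nc * snr := by positivity
  have hI := le_mutualInfo (ρ := (1 - η) * Nc * snr / (Nc - 1)) (by positivity) hE0
  have hs0 : 0 ≤ 1 / (1 + η * Nc * snr) := by positivity
  set s := 1 / (1 + η * Nc * snr)
  set g := (Nc - 1) / Nc with hg
  have hg0 : 0 < g := by positivity
  set ρ := (1 - η) * Nc * snr / (Nc - 1) with hρ
  set d := (1 - η) * snr with hd
  have hd0 : 0 ≤ d := by positivity
  have hd1 : d ≤ snr := by rw [hd]; nlinarith
  have hgρ : g * ρ = d := by rw [hg, hρ, hd]; field_simp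
  refine le_trans ?_ (mul_le_mul_of_nonneg_left hI hg0.le)
  have e1 : g * (ρ * (1 - s) - ρ ^ 2 * (1 + s)) = d * (1 - s) - d * ρ * (1 + s) := by
    rw [← hgρ]; ring
  rw [e1]
  have hρ0 : 0 ≤ ρ := by positivity
  -- N_c/(N_c − 1) ≤ 1 + 2/N_c because N_c ≥ 2.
  have hρ1 : ρ ≤ snr * (1 + 2 / Nc) := by
    rw [hρ, div_le_iff₀ hN1]
    have : snr * (1 + 2 / Nc) * (Nc - 1) = snr * ((Nc + 2) * (Nc - 1) / Nc) := by field_simp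
    rw [this]
    have h2 : Nc ≤ (Nc + 2) * (Nc - 1) / Nc := by rw [le_div_iff₀ hN0]; nlinarith
    have h3 : (1 - η) * Nc * snr ≤ Nc * snr := by
      nlinarith [mul_nonneg hη0 (mul_nonneg hN0.le hsnr.le)]
    nlinarith
  have b1 : d * ρ ≤ snr ^ 2 + 2 * snr ^ 2 / Nc := by
    calc d * ρ ≤ snr * (snr * (1 + 2 / Nc)) := by gcongr
      _ = _ := by ring
  have b2 : d * ρ ≤ 2 * snr ^ 2 := by
    have h1 : 2 / Nc ≤ 1 := by rw [div_le_one hN0]; exact hN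
    calc d * ρ ≤ snr * (snr * (1 + 2 / Nc)) := by gcongr
      _ ≤ snr * (snr * (1 + 1)) := by gcongr
      _ = _ := by ring
  have b3 : s * (d * ρ) ≤ s * (2 * snr ^ 2) := mul_le_mul_of_nonneg_left b2 hs0
  have b4 : snr - (η + s) * snr ≤ d * (1 - s) := by
    rw [hd]; nlinarith [mul_nonneg (mul_nonneg hη0 hs0) hsnr.le]
  nlinarith

/-! ### The low-SNR regime -/

lemma tendsto_rpow_nhdsGT_zero {p : ℝ} (hp : 0 < p) :
    Tendsto (fun x : ℝ => x ^ p) (𝓝[>] 0) (𝓝 0) := by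
  have h := (Real.continuousAt_rpow_const 0 p (Or.inr hp.le)).tendsto
  rw [Real.zero_rpow hp.ne'] at h
  exact h.mono_left nhdsWithin_le_nhds

lemma tendsto_id_nhdsGT_zero : Tendsto (fun x : ℝ => x) (𝓝[>] 0) (𝓝 0) :=
  tendsto_id.mono_left nhdsWithin_le_nhds

lemma eventually_pos_and_le {c : ℝ} (hc : 0 < c) : ∀ᶠ x : ℝ in 𝓝[>] 0, 0 < x ∧ x ≤ c := by
  filter_upwards [Ioo_mem_nhdsGT hc] with x hx using ⟨hx.1, hx.2.le⟩

lemma eventually_two_le_coherence {k μ : ℝ} (hk : 0 < k) (hμ : 0 < μ) :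
    ∀ᶠ snr : ℝ in 𝓝[>] 0, 2 ≤ k / snr ^ μ := by
  filter_upwards [(tendsto_rpow_nhdsGT_zero hμ).eventually_le_const
    (show (0 : ℝ) < k / 2 by positivity), self_mem_nhdsWithin] with x hx hx0
  have : 0 < x ^ μ := Real.rpow_pos_of_pos hx0 _
  rw [le_div_iff₀ this]
  linarith

lemma log_two_pos : 0 < Real.log 2 := Real.log_pos (by norm_num)

lemma logb_two_exp_one : Real.logb 2 (Real.exp 1) = 1 / Real.log 2 := by
  rw [Real.logb, Real.log_exp]

/-! ### Bounds for the optimized rate -/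

lemma avgMutualInfo_mul_log_two_le {k μ snr : ℝ} (hsnr : 0 < snr) (hsnr' : snr ≤ 1 / 10)
    (hN : 2 ≤ k / snr ^ μ) :
    avgMutualInfo k μ snr * Real.log 2 ≤ snr - snr ^ 2
      - snr / (2 * (1 + Real.sqrt (k / snr ^ μ * snr))) + 8 * snr ^ 3 := by
  rw [← le_div_iff₀ log_two_pos]
  refine ciSup_le fun η => ?_
  rw [le_div_iff₀ log_two_pos]
  exact trainingRate_mul_log_two_le hN hsnr hsnr' η.2.1 η.2.2

lemma trainingRate_le_avgMutualInfo {k μ snr η : ℝ} (hsnr : 0 < snr) (hsnr' : snr ≤ 1 / 10)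
    (hN : 2 ≤ k / snr ^ μ) (hη0 : 0 ≤ η) (hη1 : η ≤ 1) :
    trainingRate (k / snr ^ μ) snr η ≤ avgMutualInfo k μ snr := by
  refine le_ciSup (f := fun η : Set.Icc (0 : ℝ) 1 => trainingRate (k / snr ^ μ) snr η) ?_
    ⟨η, hη0, hη1⟩
  -- A real supremum dominates its terms only for a bounded family; the upper bound uniform in η
  -- supplies this.
  refine ⟨(snr - snr ^ 2 - snr / (2 * (1 + Real.sqrt (k / snr ^ μ * snr))) + 8 * snr ^ 3)
    / Real.log 2, ?_⟩
  rintro _ ⟨η, rfl⟩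
  dsimp only
  rw [le_div_iff₀ log_two_pos]
  exact trainingRate_mul_log_two_le hN hsnr hsnr' η.2.1 η.2.2

lemma avgMutualInfo_nonneg {k μ snr : ℝ} (hN : 2 ≤ k / snr ^ μ) : 0 ≤ avgMutualInfo k μ snr :=
  Real.iSup_nonneg fun _ => trainingRate_nonneg (by linarith)

lemma le_avgMutualInfo_mul_log_two_of_one_lt {k μ snr : ℝ} (hk : 0 < k) (hμ : 1 < μ)
    (hsnr : 0 < snr) (hsnr' : snr ≤ 1 / 10) (hN : 2 ≤ k / snr ^ μ) :
    snr - snr ^ 2 - (1 + 5 / k) * snr ^ ((1 + μ) / 2) ≤ avgMutualInfo k μ snr * Real.log 2 := by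
  -- This split has the order of 1/√(N_c SNR) and balances the two losses: the training energy
  -- becomes k/η, so the error variance is at most η/k.
  have hη0 : 0 < snr ^ ((μ - 1) / 2) := Real.rpow_pos_of_pos hsnr _
  have hη1 : snr ^ ((μ - 1) / 2) ≤ 1 :=
    Real.rpow_le_one hsnr.le (by linarith) (by linarith)
  have h1 := le_trainingRate_mul_log_two hN hsnr hη0.le hη1
  have h2 := mul_le_mul_of_nonneg_right (trainingRate_le_avgMutualInfo hsnr hsnr' hN hη0.le hη1)
    log_two_pos.le
  refine le_trans ?_ (h1.trans h2)
  set η := snr ^ ((μ - 1) / 2) with hη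
  set τ := snr ^ ((1 + μ) / 2) with hτ
  have hητ : η * snr = τ := by
    rw [hη, hτ, ← Real.rpow_add_one hsnr.ne']; congr 1; ring
  have hE : η * (k / snr ^ μ) * snr = k / η := by
    have h3 : snr ^ μ = η * η * snr := by
      rw [hη, ← Real.rpow_add hsnr, ← Real.rpow_add_one hsnr.ne']; congr 1; ring
    rw [h3]; field_simp
  rw [hE]
  have hs : 1 / (1 + k / η) ≤ η / k := by
    rw [div_le_div_iff₀ (by positivity) hk]
    have : η * (1 + k / η) = η + k := by field_simp
    linarith
  have hsτ : 1 / (1 + k / η) * snr ≤ τ / k := by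
    calc 1 / (1 + k / η) * snr ≤ η / k * snr := by gcongr
      _ = τ / k := by rw [← hητ]; ring
  have hs0 : 0 ≤ 1 / (1 + k / η) := by positivity
  set s := 1 / (1 + k / η)
  have hs2 : s * snr ^ 2 ≤ τ / k := by
    refine le_trans ?_ hsτ
    gcongr
    nlinarith
  have hNτ : snr ^ 2 / (k / snr ^ μ) ≤ τ / k := by
    have : snr ^ 2 / (k / snr ^ μ) = snr ^ (2 + μ) / k := by
      rw [Real.rpow_add hsnr, Real.rpow_two]; field_simp
    rw [this]
    gcongr
    exact Real.rpow_le_rpow_of_exponent_ge hsnr (by linarith) (by linarith)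
  -- Training costs τ; the estimation error costs τ/k, the lost dimension and the quadratic
  -- correction 2τ/k each.
  have e1 : (1 + 5 / k) * τ = η * snr + 5 * (τ / k) := by rw [← hητ]; ring
  have e2 : 2 * snr ^ 2 / (k / snr ^ μ) = 2 * (snr ^ 2 / (k / snr ^ μ)) := by ring
  rw [e1, e2]
  linarith

lemma eventually_le_avgMutualInfo {k μ : ℝ} (hk : 0 < k) (hμ : 0 < μ) :
    ∀ᶠ snr : ℝ in 𝓝[>] 0, snr - snr ^ 2 - (1 + 5 / k) * snr ^ ((1 + μ) / 2)
      ≤ avgMutualInfo k μ snr * Real.log 2 := by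
  filter_upwards [eventually_pos_and_le (show (0 : ℝ) < 1 / 10 by norm_num),
    eventually_two_le_coherence hk hμ] with snr hsnr hN
  -- For μ ≤ 1 the error term already exceeds SNR, and nonnegativity of the rate is enough.
  rcases le_or_gt μ 1 with h | h
  · have h1 : snr ≤ snr ^ ((1 + μ) / 2) := by
      have := Real.rpow_le_rpow_of_exponent_ge hsnr.1 (by linarith [hsnr.2])
        (show (1 + μ) / 2 ≤ 1 by linarith)
      rwa [Real.rpow_one] at this
    have h2 := mul_nonneg (avgMutualInfo_nonneg hN) log_two_pos.le
    have h3 : 0 ≤ 5 / k * snr ^ ((1 + μ) / 2) :=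
      mul_nonneg (by positivity) (Real.rpow_nonneg hsnr.1.le _)
    nlinarith
  · exact le_avgMutualInfo_mul_log_two_of_one_lt hk h hsnr.1 hsnr.2 hN

lemma eventually_avgMutualInfo_le {k μ : ℝ} (hk : 0 < k) (hμ : 0 < μ) :
    ∀ᶠ snr : ℝ in 𝓝[>] 0, avgMutualInfo k μ snr * Real.log 2 ≤ snr - snr ^ 2
      - snr / (2 * (1 + Real.sqrt (k / snr ^ μ * snr))) + 8 * snr ^ 3 := by
  filter_upwards [eventually_pos_and_le (show (0 : ℝ) < 1 / 10 by norm_num),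
    eventually_two_le_coherence hk hμ] with snr hsnr hN
  exact avgMutualInfo_mul_log_two_le hsnr.1 hsnr.2 hN

lemma coherentCapacity_mul_log_two (snr : ℝ) :
    coherentCapacity snr * Real.log 2 = ∫ h, Real.log (1 + snr * ‖h‖ ^ 2) ∂stdCN := by
  unfold coherentCapacity Real.logb
  rw [integral_div, div_mul_cancel₀ _ log_two_pos.ne']

/-! ### Energy per bit and wideband slope -/

lemma tendsto_div_of_hasEbN0 {R : ℝ → ℝ} (h : HasEbN0 R (Real.log 2)) :
    Tendsto (fun snr => R snr * Real.log 2 / snr) (𝓝[>] 0) (𝓝 1) := by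
  have h1 := (h.inv₀ log_two_pos.ne').const_mul (Real.log 2)
  rw [mul_inv_cancel₀ log_two_pos.ne'] at h1
  refine h1.congr fun x => ?_
  rw [inv_div]; ring

lemma hasEbN0_of_tendsto_div {R : ℝ → ℝ}
    (h : Tendsto (fun snr => R snr * Real.log 2 / snr) (𝓝[>] 0) (𝓝 1)) :
    HasEbN0 R (Real.log 2) := by
  have h1 := (h.inv₀ one_ne_zero).const_mul (Real.log 2)
  rw [inv_one, mul_one] at h1
  refine h1.congr fun x => ?_
  have := log_two_pos.ne'
  rw [inv_div]
  field_simp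

/-- The decibel factors cancel: with m = R log 2 / x, the slope is the limit of m x / (−log m). -/
lemma widebandSlope_expr {R x : ℝ} (hR : 0 < R) (hx : 0 < x) :
    R / (10 * Real.logb 10 (x / R) - 10 * Real.logb 10 (Real.log 2)) * (10 * Real.logb 10 2)
      = R * Real.log 2 / -Real.log (R * Real.log 2 / x) := by
  have h2 := log_two_pos
  have h10 : 0 < Real.log 10 := Real.log_pos (by norm_num)
  have e : -Real.log (R * Real.log 2 / x) = Real.log (x / R) - Real.log (Real.log 2) := by
    rw [Real.log_div (by positivity) hx.ne', Real.log_div hx.ne' hR.ne',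
      Real.log_mul hR.ne' h2.ne']
    ring
  rw [e]
  unfold Real.logb
  rw [show 10 * (Real.log (x / R) / Real.log 10) - 10 * (Real.log (Real.log 2) / Real.log 10)
    = (Real.log (x / R) - Real.log (Real.log 2)) * (10 / Real.log 10) by ring,
    ← div_div, div_mul_eq_mul_div, div_div_eq_mul_div]
  field_simp

lemma tendsto_one_of_second_order {m : ℝ → ℝ}
    (h : Tendsto (fun x => (m x - 1) / x) (𝓝[>] 0) (𝓝 (-1))) :
    Tendsto m (𝓝[>] 0) (𝓝 1) := by
  have h1 := (h.mul tendsto_id_nhdsGT_zero).add_const 1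
  rw [mul_zero, zero_add] at h1
  refine h1.congr' ?_
  filter_upwards [self_mem_nhdsWithin] with x hx
  rw [div_mul_cancel₀ _ (ne_of_gt hx)]
  ring

/-- A spectral efficiency `log₂(e) (snr - snr² + o(snr²))` has wideband slope one. -/
lemma hasWidebandSlope_one {R : ℝ → ℝ}
    (h : Tendsto (fun x => (R x * Real.log 2 / x - 1) / x) (𝓝[>] 0) (𝓝 (-1))) :
    HasWidebandSlope R (Real.log 2) 1 := by
  have hm := tendsto_one_of_second_order h
  have hpos : ∀ᶠ x : ℝ in 𝓝[>] 0, 0 < x ∧ 0 < R x := by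
    filter_upwards [hm.eventually_const_lt (show (0 : ℝ) < 1 by norm_num),
      self_mem_nhdsWithin] with x hx hx0
    have hx0' : (0 : ℝ) < x := hx0
    refine ⟨hx0', ?_⟩
    have h1 := mul_pos hx hx0'
    rw [div_mul_cancel₀ _ hx0'.ne'] at h1
    exact pos_of_mul_pos_left h1 log_two_pos.le
  -- Squeeze by 1 − 1/m ≤ log m ≤ m − 1 for m = R log 2 / x, which tends to 1.
  have hlog : Tendsto (fun x => Real.log (R x * Real.log 2 / x) / x) (𝓝[>] 0) (𝓝 (-1)) := by
    have hlow : Tendsto (fun x => (R x * Real.log 2 / x - 1) / x / (R x * Real.log 2 / x))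
        (𝓝[>] 0) (𝓝 (-1)) := by
      have h1 := h.div hm one_ne_zero
      rwa [div_one] at h1
    refine tendsto_of_tendsto_of_tendsto_of_le_of_le' hlow h ?_ ?_
    · filter_upwards [hpos] with x hx
      have h2 := log_two_pos
      have hmp : 0 < R x * Real.log 2 / x := by
        have := hx.1; have := hx.2; positivity
      rw [div_right_comm]
      refine div_le_div_of_nonneg_right ?_ hx.1.le
      have := Real.one_sub_inv_le_log_of_pos hmp
      rwa [sub_div, div_self hmp.ne', one_div]
    · filter_upwards [hpos] with x hx
      have h2 := log_two_pos
      have hmp : 0 < R x * Real.log 2 / x := by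
        have := hx.1; have := hx.2; positivity
      exact div_le_div_of_nonneg_right (Real.log_le_sub_one_of_pos hmp) hx.1.le
  have hq := hm.div hlog.neg (by norm_num)
  rw [neg_neg, div_one] at hq
  refine hq.congr' ?_
  filter_upwards [hpos] with x hx
  rw [widebandSlope_expr hx.2 hx.1]
  have := hx.1.ne'
  simp only [Pi.div_apply]
  rw [← neg_div, div_div_div_cancel_right₀ this]

/-- A second-order loss beyond that of the coherent channel lowers the wideband slope. -/
lemma widebandSlope_lt_one {R : ℝ → ℝ} {δ S : ℝ} (hδ : 0 < δ)
    (he : HasEbN0 R (Real.log 2)) (hS : HasWidebandSlope R (Real.log 2) S)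
    (h : ∀ᶠ x : ℝ in 𝓝[>] 0, R x * Real.log 2 ≤ x - (1 + δ) * x ^ 2) : S < 1 := by
  have hm := tendsto_div_of_hasEbN0 he
  refine lt_of_le_of_lt (b := 1 / (1 + δ)) (le_of_tendsto hS ?_) (by
    rw [div_lt_one (by positivity)]; linarith)
  filter_upwards [h, hm.eventually_const_lt (show (0 : ℝ) < 1 by norm_num),
    self_mem_nhdsWithin] with x hx hmx hx0
  have hx0' : (0 : ℝ) < x := hx0
  have hN : 0 < R x * Real.log 2 := by
    have h1 := mul_pos hmx hx0'
    rwa [div_mul_cancel₀ _ hx0'.ne'] at h1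
  have hR : 0 < R x := pos_of_mul_pos_left hN log_two_pos.le
  rw [widebandSlope_expr hR hx0']
  have hl : (1 + δ) * x ≤ -Real.log (R x * Real.log 2 / x) := by
    have h1 := Real.log_le_sub_one_of_pos hmx
    have h2 : R x * Real.log 2 / x ≤ 1 - (1 + δ) * x := by
      rw [div_le_iff₀ hx0']; nlinarith
    linarith
  have hl0 : 0 < (1 + δ) * x := by positivity
  have hNx : R x * Real.log 2 ≤ x := by nlinarith [sq_nonneg x]
  calc R x * Real.log 2 / -Real.log (R x * Real.log 2 / x) ≤ x / ((1 + δ) * x) := by gcongr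
    _ = 1 / (1 + δ) := by field_simp

/-- Used for the capacity with κ = 3, c = 0, and for the training scheme with κ = (1+μ)/2, where κ >
2 is the condition μ > 3. -/
lemma tendsto_second_order_of_bounds {R : ℝ → ℝ} {κ c c' : ℝ} (hκ : 2 < κ)
    (hl : ∀ᶠ x : ℝ in 𝓝[>] 0, x - x ^ 2 - c * x ^ κ ≤ R x * Real.log 2)
    (hu : ∀ᶠ x : ℝ in 𝓝[>] 0, R x * Real.log 2 ≤ x - x ^ 2 + c' * x ^ 3) :
    Tendsto (fun x => (R x * Real.log 2 / x - 1) / x) (𝓝[>] 0) (𝓝 (-1)) := by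
  have h1 : Tendsto (fun x : ℝ => -1 - c * x ^ (κ - 2)) (𝓝[>] 0) (𝓝 (-1)) := by
    simpa using ((tendsto_rpow_nhdsGT_zero (show 0 < κ - 2 by linarith)).const_mul c).const_sub
      (-1)
  have h2 : Tendsto (fun x : ℝ => -1 + c' * x) (𝓝[>] 0) (𝓝 (-1)) := by
    simpa using (tendsto_id_nhdsGT_zero.const_mul c').const_add (-1)
  refine tendsto_of_tendsto_of_tendsto_of_le_of_le' h1 h2 ?_ ?_
  · filter_upwards [hl, self_mem_nhdsWithin] with x hx hx0
    have hx0' : (0 : ℝ) < x := hx0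
    have e : x ^ κ = x ^ (κ - 2) * x ^ 2 := by
      rw [← Real.rpow_two, ← Real.rpow_add hx0']; congr 1; ring
    rw [e] at hx
    rw [le_div_iff₀ hx0', le_sub_iff_add_le, le_div_iff₀ hx0']
    nlinarith
  · filter_upwards [hu, self_mem_nhdsWithin] with x hx hx0
    have hx0' : (0 : ℝ) < x := hx0
    rw [div_le_iff₀ hx0', sub_le_iff_le_add, div_le_iff₀ hx0']
    nlinarith

/-! ### The coherent capacity and the two thresholds for μ -/

lemma tendsto_second_order_coherentCapacity :
    Tendsto (fun x => (coherentCapacity x * Real.log 2 / x - 1) / x) (𝓝[>] 0) (𝓝 (-1)) := by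
  refine tendsto_second_order_of_bounds (κ := 3) (c := 0) (c' := 2) (by norm_num) ?_ ?_
  · filter_upwards [self_mem_nhdsWithin] with x hx
    rw [coherentCapacity_mul_log_two, zero_mul, sub_zero]
    exact quadratic_le_integral_log_stdCN (le_of_lt hx)
  · filter_upwards [self_mem_nhdsWithin] with x hx
    rw [coherentCapacity_mul_log_two]
    have := integral_log_stdCN_le_cubic (c := 0) le_rfl (le_of_lt hx)
    simp only [add_zero] at this
    linarith

lemma hasEbN0_coherentCapacity : HasEbN0 coherentCapacity (Real.log 2) :=
  hasEbN0_of_tendsto_div (tendsto_one_of_second_order tendsto_second_order_coherentCapacity)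

lemma eq_log_two_of_hasEbN0_coherentCapacity {e : ℝ} (h : HasEbN0 coherentCapacity e) :
    e = Real.log 2 := tendsto_nhds_unique h hasEbN0_coherentCapacity

lemma hasEbN0_avgMutualInfo {k μ : ℝ} (hk : 0 < k) (hμ : 1 < μ) :
    HasEbN0 (avgMutualInfo k μ) (Real.log 2) := by
  apply hasEbN0_of_tendsto_div
  have h1 : Tendsto (fun x : ℝ => 1 - x - (1 + 5 / k) * x ^ ((μ - 1) / 2)) (𝓝[>] 0) (𝓝 1) := by
    simpa using (tendsto_id_nhdsGT_zero.const_sub 1).sub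
      ((tendsto_rpow_nhdsGT_zero (show 0 < (μ - 1) / 2 by linarith)).const_mul (1 + 5 / k))
  have h2 : Tendsto (fun x : ℝ => 1 + 8 * (x * x)) (𝓝[>] 0) (𝓝 1) := by
    simpa using ((tendsto_id_nhdsGT_zero.mul tendsto_id_nhdsGT_zero).const_mul 8).const_add 1
  refine tendsto_of_tendsto_of_tendsto_of_le_of_le' h1 h2 ?_ ?_
  · filter_upwards [eventually_le_avgMutualInfo hk (by linarith : 0 < μ), self_mem_nhdsWithin]
      with x hx hx0
    have hx0' : (0 : ℝ) < x := hx0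
    have e : x ^ ((1 + μ) / 2) = x ^ ((μ - 1) / 2) * x := by
      rw [← Real.rpow_add_one hx0'.ne']; congr 1; ring
    rw [e] at hx
    rw [le_div_iff₀ hx0']
    nlinarith
  · filter_upwards [eventually_avgMutualInfo_le hk (by linarith : 0 < μ), self_mem_nhdsWithin]
      with x hx hx0
    have hx0' : (0 : ℝ) < x := hx0
    have : 0 ≤ x / (2 * (1 + Real.sqrt (k / x ^ μ * x))) := by positivity
    rw [div_le_iff₀ hx0']
    nlinarith [sq_nonneg x]

/-- Source of both thresholds: as x ↓ 0 this stays bounded exactly for μ ≤ 1 and is O(1/x) exactly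
for μ ≤ 3. -/
lemma sqrt_coherence_energy {k μ x : ℝ} (hk : 0 < k) (hx : 0 < x) :
    Real.sqrt (k / x ^ μ * x) = Real.sqrt k * x ^ ((1 - μ) / 2) := by
  have : k / x ^ μ * x = k * (x ^ ((1 - μ) / 2)) ^ 2 := by
    rw [← Real.rpow_natCast, ← Real.rpow_mul hx.le, div_mul_eq_mul_div, mul_div_assoc]
    congr 1
    rw [show (1 - μ) / 2 * ((2 : ℕ) : ℝ) = 1 - μ by push_cast; ring, Real.rpow_sub hx,
      Real.rpow_one]
  rw [this, Real.sqrt_mul hk.le, Real.sqrt_sq (Real.rpow_nonneg hx.le _)]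

/-- For μ ≤ 1 the energy of a coherence subspace stays bounded, so a fixed fraction δ of the SNR is
lost whatever the split. -/
lemma not_hasEbN0_avgMutualInfo {k μ : ℝ} (hk : 0 < k) (hμ : 0 < μ) (hμ1 : μ ≤ 1) :
    ¬ HasEbN0 (avgMutualInfo k μ) (Real.log 2) := by
  intro h
  have hm := tendsto_div_of_hasEbN0 h
  set δ := 1 / (2 * (1 + Real.sqrt k)) with hδ
  have hδ0 : 0 < δ := by positivity
  have h2 : Tendsto (fun x : ℝ => 1 - δ + 8 * (x * x)) (𝓝[>] 0) (𝓝 (1 - δ)) := by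
    simpa using ((tendsto_id_nhdsGT_zero.mul tendsto_id_nhdsGT_zero).const_mul 8).const_add (1 - δ)
  have : (1 : ℝ) ≤ 1 - δ := by
    refine le_of_tendsto_of_tendsto hm h2 ?_
    filter_upwards [eventually_avgMutualInfo_le hk hμ, eventually_pos_and_le one_pos]
      with x hx hx0
    have hr : Real.sqrt (k / x ^ μ * x) ≤ Real.sqrt k := by
      rw [sqrt_coherence_energy hk hx0.1]
      exact mul_le_of_le_one_right (Real.sqrt_nonneg _)
        (Real.rpow_le_one hx0.1.le hx0.2 (by linarith))
    have h3 : x * δ ≤ x / (2 * (1 + Real.sqrt (k / x ^ μ * x))) := by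
      rw [hδ, mul_one_div]
      have := hx0.1
      gcongr
    rw [div_le_iff₀ hx0.1]
    nlinarith [sq_nonneg x]
  linarith

lemma eventually_avgMutualInfo_le_of_le_three {k μ : ℝ} (hk : 0 < k) (hμ : 0 < μ) (hμ3 : μ ≤ 3) :
    ∀ᶠ x : ℝ in 𝓝[>] 0, avgMutualInfo k μ x * Real.log 2
      ≤ x - (1 + 1 / (4 * (1 + Real.sqrt k))) * x ^ 2 := by
  -- The loss is at least 2δ x²; one half is kept, the other absorbs 8x³ once x ≤ δ/8.
  set δ := 1 / (4 * (1 + Real.sqrt k)) with hδ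
  have hδ0 : 0 < δ := by positivity
  filter_upwards [eventually_avgMutualInfo_le hk hμ, eventually_pos_and_le one_pos,
    eventually_pos_and_le (show 0 < δ / 8 by positivity)] with x hx hx0 hxδ
  have hx1 := hx0.1
  have hr : Real.sqrt (k / x ^ μ * x) ≤ Real.sqrt k / x := by
    rw [sqrt_coherence_energy hk hx1, div_eq_mul_inv (Real.sqrt k), ← Real.rpow_neg_one x]
    exact mul_le_mul_of_nonneg_left
      (Real.rpow_le_rpow_of_exponent_ge hx1 hx0.2 (by linarith)) (Real.sqrt_nonneg k)
  have h3 : 2 * δ * x ^ 2 ≤ x / (2 * (1 + Real.sqrt (k / x ^ μ * x))) := by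
    have h4 : 1 + Real.sqrt (k / x ^ μ * x) ≤ (1 + Real.sqrt k) / x := by
      rw [add_div]
      have : 1 ≤ 1 / x := by rw [le_div_iff₀ hx1]; linarith [hx0.2]
      linarith
    calc 2 * δ * x ^ 2 = x / (2 * ((1 + Real.sqrt k) / x)) := by rw [hδ]; field_simp; norm_num
      _ ≤ _ := by gcongr
  have h5 : 8 * x ^ 3 ≤ δ * x ^ 2 := by
    have := mul_le_mul_of_nonneg_right hxδ.2 (sq_nonneg x)
    nlinarith
  linarith

end TrainingSTF

theorem theorem1 (k μ : ℝ) (hk : 0 < k) (hμ : 0 < μ) :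
    (∃ c : ℝ, ∀ᶠ snr : ℝ in 𝓝[>] 0,
      Real.logb 2 (Real.exp 1) * (snr - snr ^ 2 - c * snr ^ ((1 + μ) / 2))
        ≤ TrainingSTF.avgMutualInfo k μ snr) ∧
    (μ ≤ 3 → ∃ c : ℝ, ∀ᶠ snr : ℝ in 𝓝[>] 0,
      Real.logb 2 (Real.exp 1) * (snr - c * snr ^ ((1 + μ) / 2))
        ≤ TrainingSTF.avgMutualInfo k μ snr) ∧
    (TrainingSTF.FirstOrderOptimal TrainingSTF.coherentCapacity
      (TrainingSTF.avgMutualInfo k μ) ↔ 1 < μ) ∧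
    (TrainingSTF.SecondOrderOptimal TrainingSTF.coherentCapacity
      (TrainingSTF.avgMutualInfo k μ) ↔ 3 < μ) := by
  open TrainingSTF in
  have hlog2 := log_two_pos
  refine ⟨⟨1 + 5 / k, ?_⟩, fun hμ3 => ⟨2 + 5 / k, ?_⟩, ⟨?_, ?_⟩, ⟨?_, ?_⟩⟩
  · filter_upwards [eventually_le_avgMutualInfo hk hμ] with x hx
    rw [logb_two_exp_one, one_div_mul_eq_div, div_le_iff₀ hlog2]
    exact hx
  · filter_upwards [eventually_le_avgMutualInfo hk hμ, eventually_pos_and_le one_pos] with x hx hx0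
    rw [logb_two_exp_one, one_div_mul_eq_div, div_le_iff₀ hlog2]
    -- For μ ≤ 3 the exponent is at most 2, so the quadratic term joins the error and adds 1 to its
    -- constant.
    have h1 : x ^ 2 ≤ x ^ ((1 + μ) / 2) := by
      rw [← Real.rpow_two]
      exact Real.rpow_le_rpow_of_exponent_ge hx0.1 hx0.2 (by linarith)
    linarith
  · rintro ⟨e, hC, hR⟩
    rw [eq_log_two_of_hasEbN0_coherentCapacity hC] at hR
    by_contra hle
    exact not_hasEbN0_avgMutualInfo hk hμ (not_lt.1 hle) hR
  · intro h
    exact ⟨Real.log 2, hasEbN0_coherentCapacity, hasEbN0_avgMutualInfo hk h⟩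
  · rintro ⟨e, S, hC, hR, hSC, hSR⟩
    obtain rfl := eq_log_two_of_hasEbN0_coherentCapacity hC
    obtain rfl : S = 1 :=
      tendsto_nhds_unique hSC (hasWidebandSlope_one tendsto_second_order_coherentCapacity)
    by_contra hle
    exact lt_irrefl _ (widebandSlope_lt_one (by positivity) hR hSR
      (eventually_avgMutualInfo_le_of_le_three hk hμ (not_lt.1 hle)))
  · intro h
    refine ⟨Real.log 2, 1, hasEbN0_coherentCapacity, hasEbN0_avgMutualInfo hk (by linarith),
      hasWidebandSlope_one tendsto_second_order_coherentCapacity, hasWidebandSlope_one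
        (tendsto_second_order_of_bounds (κ := (1 + μ) / 2) (c' := 8) (by linarith)
          (eventually_le_avgMutualInfo hk hμ) ?_)⟩
    filter_upwards [eventually_avgMutualInfo_le hk hμ, self_mem_nhdsWithin] with x hx hx0
    have hx0' : (0 : ℝ) < x := hx0
    have : 0 ≤ x / (2 * (1 + Real.sqrt (k / x ^ μ * x))) := by positivity
    linarith
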